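/- Let $\mathcal X,\mathcal Y$ be metric spaces, $\mu$ a Borel probability measure on $\mathcal X$, and $\nu=\sum_{j=1}^J\nu_j\delta_{y_j}$ with distinct points $y_1,\dots,y_J\in\mathcal Y$ and weights $\nu_j>0$, $\sum_j\nu_j=1$. Let $c:\mathcal X\times\mathcal Y\to[0,\infty)$ be lower semi-continuous and let $\varepsilon>0$. Put $$W_\varepsilon(\mu,\nu)=\min_{\pi\in\Pi(\mu,\nu)}\int c\,d\pi+\varepsilon\,\mathrm{KL}(\pi\,|\,\mu\otimes\nu),\qquad \mathrm{KL}(\pi|\xi)=\int\Bigl(\log\frac{d\pi}{d\xi}-1\Bigr)d\pi$$ ($\mathrm{KL}(\pi|\xi)=+\infty$ if $\pi\not\ll\xi$), where $\Pi(\mu,\nu)$ is the set of probability measures on $\mathcal X\times\mathcal Y$ with marginals $\mu$ and $\nu$, and, for $x\in\mathcal X$, $v\in\mathbb R^J$, $$h_\varepsilon(x,v)=\varepsilon+\varepsilon\log\Bigl(\sum_{j=1}^J\exp\Bigl(\frac{v_j-c(x,y_j)}{\varepsilon}\Bigr)\nu_j\Bigr)-\sum_{j=1}^Jv_j\nu_j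 .$$ Let $\boldsymbol v_J=J^{-1/2}(1,\dots,1)^T$, $P_J=I_J-\boldsymbol v_J\boldsymbol v_J^T$, and $Z_k=\sqrt{\nu_{\ell_k}}\,e_{\ell_k}$ with $\ell_k=1+((k-1)\bmod J)$, where $(e_1,\dots,e_J)$ is the canonical basis of $\mathbb R^J$. Let $X_1,X_2,\dots$ be i.i.d. with law $\mu$, and let $\widehat V_0$ be a square-integrable random vector in $\langle\boldsymbol v_J\rangle^\perp$, independent of $(X_n)_{n\ge1}$. Let $\gamma>0$, $\alpha\in[0,1/2)$, $\beta\in(0,1/2)$. The stochastic Gauss--Newton algorithm is defined by $S_0=I_J$ and, for $n\ge0$, with $\phi_{n+1}=\nabla_vh_\varepsilon(X_{n+1},\widehat V_n)$, $$\widehat V_{n+1}=P_J\bigl(\widehat V_n-n^\alpha S_n^{-1}\phi_{n+1}\bigr),\qquad S_{n+1}=S_n+\phi_{n+1}\phi_{n+1}^T+\gamma\Bigl(1+\Bigl\lfloor\frac{n+1}{J}\Bigr\rfloor\Bigr)^{-\beta}Z_{n+1}Z_{n+1}^T .$$ Set $\widehat W_n=-\frac1n\sum_{k=1}^nh_\varepsilon(X_k,\widehat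 V_{k-1})$. Assume that $\alpha+\beta<1/2$ and that $\int_{\mathcal X}c^2(x,y_j)\,d\mu(x)<+\infty$ for every $1\le j\le J$. Then the minimum defining $W_\varepsilon(\mu,\nu)$ is attained and finite, and $$\lim_{n\to+\infty}\widehat W_n=W_\varepsilon(\mu,\nu)\qquad\text{almost surely.}$$ -/

import Mathlib

open MeasureTheory ProbabilityTheory Filter Topology

namespace RegOT

noncomputable section

/-- The set `Π(μ, ν)` of measures on `𝒳 × 𝒴` with marginals `μ` and `ν`. -/
def couplings {𝒳 𝒴 : Type*} [MeasurableSpace 𝒳] [MeasurableSpace 𝒴]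
    (μ : Measure 𝒳) (ν : Measure 𝒴) : Set (Measure (𝒳 × 𝒴)) :=
  {π | π.fst = μ ∧ π.snd = ν}

open Classical in
/-- `KL(π | ξ) = ∫ (log (dπ/dξ) - 1) dπ`, equal to `+∞` if `π` is not absolutely continuous with
respect to `ξ` or if the integral diverges. (For finite measures the negative part of
`log (dπ/dξ)` is always `π`-integrable, so that divergence can only be to `+∞`.) -/
def KL {Z : Type*} [MeasurableSpace Z] (π ξ : Measure Z) : EReal :=
  if π ≪ ξ ∧ Integrable (fun z => Real.log (π.rnDeriv ξ z).toReal) π then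
    ((∫ z, (Real.log (π.rnDeriv ξ z).toReal - 1) ∂π : ℝ) : EReal)
  else ⊤

/-- The objective `∫ c dπ + ε KL(π | μ ⊗ ν)` of regularized optimal transport, for a nonnegative
cost `c` and `ε > 0`. -/
def transportCost {𝒳 𝒴 : Type*} [MeasurableSpace 𝒳] [MeasurableSpace 𝒴]
    (c : 𝒳 × 𝒴 → ℝ) (ε : ℝ) (μ : Measure 𝒳) (ν : Measure 𝒴) (π : Measure (𝒳 × 𝒴)) : EReal :=
  ((∫⁻ z, ENNReal.ofReal (c z) ∂π : ENNReal) : EReal) + (ε : EReal) * KL π (μ.prod ν)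

/-- The regularized optimal transport cost `W_ε(μ, ν)`. -/
def W {𝒳 𝒴 : Type*} [MeasurableSpace 𝒳] [MeasurableSpace 𝒴]
    (c : 𝒳 × 𝒴 → ℝ) (ε : ℝ) (μ : Measure 𝒳) (ν : Measure 𝒴) : EReal :=
  ⨅ π ∈ couplings μ ν, transportCost c ε μ ν π

/-- The discrete measure `∑ j, ν_j δ_{y_j}` with weights `w j = ν_j`. -/
def discreteMeasure {𝒴 : Type*} [MeasurableSpace 𝒴] {J : ℕ} (y : Fin J → 𝒴) (w : Fin J → ℝ) :
    Measure 𝒴 :=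
  ∑ j, ENNReal.ofReal (w j) • Measure.dirac (y j)

/-- The semi-dual integrand
`h_ε(x, v) = ε + ε log (∑ j, exp ((v_j - c(x, y_j)) / ε) ν_j) - ∑ j, v_j ν_j`. -/
def h {𝒳 𝒴 : Type*} {J : ℕ} (c : 𝒳 × 𝒴 → ℝ) (ε : ℝ) (y : Fin J → 𝒴) (w : Fin J → ℝ)
    (x : 𝒳) (v : EuclideanSpace ℝ (Fin J)) : ℝ :=
  ε + ε * Real.log (∑ j, Real.exp ((v j - c (x, y j)) / ε) * w j) - ∑ j, v j * w j

/-- The unit vector `v_J = J^{-1/2} (1, …, 1)`. -/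
def unitVec (J : ℕ) : EuclideanSpace ℝ (Fin J) :=
  WithLp.toLp 2 fun _ => 1 / Real.sqrt J

/-- The matrix `P_J = I_J - v_J v_Jᵀ` of the orthogonal projection onto the orthogonal complement
of `v_J`. -/
def projMatrix (J : ℕ) : Matrix (Fin J) (Fin J) ℝ :=
  1 - Matrix.vecMulVec (unitVec J) (unitVec J)

/-- The vector `Z_k = √ν_ℓ e_ℓ`, `ℓ = 1 + (k - 1) mod J`, for `k ≥ 1`. (Coordinates are
indexed from `0` here, so that the index of the nonzero coordinate is `(k - 1) mod J`.) -/
def Z {J : ℕ} (w : Fin J → ℝ) (k : ℕ) : Fin J → ℝ :=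
  fun j => if (j : ℕ) = (k - 1) % J then Real.sqrt (w j) else 0

/-- The pair `(V_n, S_n)` of the regularized stochastic Gauss-Newton algorithm with parameters
`α, β, γ`, started at `(v₀, I_J)`, along the sample `X_1 = x 0, X_2 = x 1, …`
(so `X_{n+1}` is `x n`):
* `V_{n+1} = P_J (V_n - n^α S_n⁻¹ ∇_v h_ε(X_{n+1}, V_n))`,
* `S_{n+1} = S_n + ∇_v h_ε(X_{n+1}, V_n) ∇_v h_ε(X_{n+1}, V_n)ᵀ
    + γ (1 + ⌊(n+1)/J⌋)^{-β} Z_{n+1} Z_{n+1}ᵀ`. -/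
def sgn {𝒳 𝒴 : Type*} {J : ℕ} (c : 𝒳 × 𝒴 → ℝ) (ε : ℝ) (y : Fin J → 𝒴) (w : Fin J → ℝ)
    (α β γ : ℝ) (x : ℕ → 𝒳) (v₀ : EuclideanSpace ℝ (Fin J)) :
    ℕ → EuclideanSpace ℝ (Fin J) × Matrix (Fin J) (Fin J) ℝ
  | 0 => (v₀, 1)
  | n + 1 =>
    let V := (sgn c ε y w α β γ x v₀ n).1
    let S := (sgn c ε y w α β γ x v₀ n).2
    let g := gradient (h c ε y w (x n)) V
    (Matrix.toEuclideanLin (projMatrix J)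
        (V - (n : ℝ) ^ α • Matrix.toEuclideanLin S⁻¹ g),
      S + Matrix.vecMulVec g g
        + (γ * (1 + (((n + 1) / J : ℕ) : ℝ)) ^ (-β)) • Matrix.vecMulVec (Z w (n + 1)) (Z w (n + 1)))

/-- The recursive estimator `Ŵ_n = -(1/n) ∑_{k=1}^n h_ε(X_k, V_{k-1})`, with `X_k = x (k - 1)`. -/
def What {𝒳 𝒴 : Type*} {J : ℕ} (c : 𝒳 × 𝒴 → ℝ) (ε : ℝ) (y : Fin J → 𝒴) (w : Fin J → ℝ)
    (α β γ : ℝ) (x : ℕ → 𝒳) (v₀ : EuclideanSpace ℝ (Fin J)) (n : ℕ) : ℝ :=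
  -(1 / (n : ℝ)) * ∑ k ∈ Finset.Icc 1 n,
    h c ε y w (x (k - 1)) (sgn c ε y w α β γ x v₀ (k - 1)).1

end

end RegOT

/-! Let H be the mean of h_ε(X, ·) under μ (`meanDual`). The theorem reduces to two facts: W_ε(μ, ν)
= -min H, and V_n converges almost surely to the minimizer v of H with coordinate sum zero.

Duality. Weak duality is the Gibbs variational inequality applied to the log-density attached to any
dual vector. For a coupling, the integral of that log-density depends only on the marginals and the
mean cost (`integral_extend_logDensity`). At a minimizer, ∇H = 0 says exactly that the Gibbs measure
has second marginal ν, so it is a coupling and attains equality.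

Convergence. h_ε is convex in v, √J-Lipschitz, smooth, and invariant under adding constants, so
projecting does not change H. The preconditioner satisfies κ (n+1)^(1-β) ≤ S_n ≤ (1+J+γ)(n+1). The
lower bound makes the steps O((n+1)^(α+β-1)), which is square summable because α + β < 1/2, so both
the second-order errors and the martingale noise in the descent inequality have convergent sums.
Hence H(V_n) converges and ∑ n^α ⟨∇H(V_n), S_n⁻¹ ∇H(V_n)⟩ is finite. By the upper bound on S_n and
divergence of the harmonic series, ∇H(V_n) is small infinitely often. Convexity and boundedness of
the iterates then force H(V_n) → min H, and compactness with uniqueness of the centered minimizer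
gives V_n → v (`IsRun.tendsto_minimizer`).

Since h_ε is Lipschitz in v uniformly in x, Cesàro averaging replaces V_(k-1) by v, and the strong
law of large numbers concludes. -/

namespace RegOT

noncomputable section

/-! ### Convexity, smoothness and invariance of the semi-dual integrand -/

section Gibbs

variable {J : ℕ}

/-- The partition function `∑ j, exp ((v_j - a_j) / ε) w_j`. -/
def partition (ε : ℝ) (w a : Fin J → ℝ) (v : EuclideanSpace ℝ (Fin J)) : ℝ :=
  ∑ j, Real.exp ((v j - a j) / ε) * w j

/-- The Gibbs weights, i.e. the normalized summands of the partition function. -/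
def gibbs (ε : ℝ) (w a : Fin J → ℝ) (v : EuclideanSpace ℝ (Fin J)) (j : Fin J) : ℝ :=
  Real.exp ((v j - a j) / ε) * w j / partition ε w a v

/-- The semi-dual integrand as a function of the vector `a` of costs. -/
def semiDual (ε : ℝ) (w a : Fin J → ℝ) (v : EuclideanSpace ℝ (Fin J)) : ℝ :=
  ε + ε * Real.log (partition ε w a v) - ∑ j, v j * w j

/-- The gradient of `semiDual` in `v`. -/
def semiDualGrad (ε : ℝ) (w a : Fin J → ℝ) (v : EuclideanSpace ℝ (Fin J)) :
    EuclideanSpace ℝ (Fin J) :=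
  WithLp.toLp 2 fun j => gibbs ε w a v j - w j

/-- Averaged over a centered variable, the linear term disappears: this is what yields a
sub-Gaussian bound on the exponential moment. For |t| ≤ 1 it is a Taylor estimate; beyond that t²
dominates |t|. -/
lemma exp_le_add_exp_sq (t : ℝ) : Real.exp t ≤ t + Real.exp (t ^ 2) := by
  have h2 := Real.add_one_le_exp (t ^ 2)
  rcases le_total |t| 1 with h | h
  · have := (abs_le.1 (Real.abs_exp_sub_one_sub_id_le h)).2
    linarith
  · rcases le_total 0 t with h0 | h0
    · rw [abs_of_nonneg h0] at h
      have : Real.exp t ≤ Real.exp (t ^ 2) := Real.exp_le_exp.2 (by nlinarith)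
      linarith
    · rw [abs_of_nonpos h0] at h
      have : Real.exp t ≤ 1 := Real.exp_le_one_iff.2 h0
      nlinarith

lemma inner_eq_sum (x z : EuclideanSpace ℝ (Fin J)) : inner ℝ x z = ∑ j, x j * z j := by
  simp [PiLp.inner_apply, mul_comm]

lemma abs_apply_le_norm (x : EuclideanSpace ℝ (Fin J)) (j : Fin J) : |x j| ≤ ‖x‖ := by
  simpa using PiLp.norm_apply_le x j

lemma norm_le_sqrt_of_abs_le {x : EuclideanSpace ℝ (Fin J)} {C : ℝ} (hC : 0 ≤ C)
    (hx : ∀ j, |x j| ≤ C) : ‖x‖ ≤ √J * C := by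
  rw [EuclideanSpace.norm_eq, ← Real.sqrt_sq hC, ← Real.sqrt_mul (by positivity)]
  refine Real.sqrt_le_sqrt ?_
  calc ∑ i, ‖x i‖ ^ 2 ≤ ∑ _i : Fin J, C ^ 2 :=
        Finset.sum_le_sum fun i _ => by
          rw [Real.norm_eq_abs]; exact pow_le_pow_left₀ (abs_nonneg _) (hx i) 2
    _ = J * C ^ 2 := by simp

variable {ε : ℝ} {w a : Fin J → ℝ} {v u : EuclideanSpace ℝ (Fin J)}

lemma nonempty_of_sum_eq_one (hw1 : ∑ j, w j = 1) : Nonempty (Fin J) := by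
  by_contra h
  rw [not_nonempty_iff] at h
  simp at hw1

lemma le_one_of_sum_eq_one (hw : ∀ j, 0 < w j) (hw1 : ∑ j, w j = 1) (j : Fin J) : w j ≤ 1 :=
  hw1 ▸ Finset.single_le_sum (fun i _ => (hw i).le) (Finset.mem_univ j)

lemma partition_pos [Nonempty (Fin J)] (hw : ∀ j, 0 < w j) : 0 < partition ε w a v :=
  Finset.sum_pos (fun j _ => mul_pos (Real.exp_pos _) (hw j)) Finset.univ_nonempty

lemma gibbs_pos [Nonempty (Fin J)] (hw : ∀ j, 0 < w j) (j : Fin J) : 0 < gibbs ε w a v j :=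
  div_pos (mul_pos (Real.exp_pos _) (hw j)) (partition_pos hw)

lemma sum_gibbs [Nonempty (Fin J)] (hw : ∀ j, 0 < w j) : ∑ j, gibbs ε w a v j = 1 := by
  simp only [gibbs, ← Finset.sum_div]
  exact div_self (partition_pos hw).ne'

/-- A shift of v tilts the Gibbs weights, so increments of the log-partition function become
log-moment generating functions under those weights. -/
lemma partition_add [Nonempty (Fin J)] (hw : ∀ j, 0 < w j) :
    partition ε w a (v + u) =
      partition ε w a v * ∑ j, gibbs ε w a v j * Real.exp (u j / ε) := by
  have := (partition_pos (ε := ε) (a := a) (v := v) hw).ne'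
  rw [Finset.mul_sum, partition]
  refine Finset.sum_congr rfl fun j _ => ?_
  rw [gibbs, PiLp.add_apply,
    show (v j + u j - a j) / ε = (v j - a j) / ε + u j / ε by ring, Real.exp_add]
  field_simp

lemma sum_gibbs_mul_exp_pos [Nonempty (Fin J)] (hw : ∀ j, 0 < w j) (t : Fin J → ℝ) :
    0 < ∑ j, gibbs ε w a v j * Real.exp (t j) :=
  Finset.sum_pos (fun j _ => mul_pos (gibbs_pos hw j) (Real.exp_pos _)) Finset.univ_nonempty

lemma semiDual_add [Nonempty (Fin J)] (hw : ∀ j, 0 < w j) :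
    semiDual ε w a (v + u) - semiDual ε w a v =
      ε * Real.log (∑ j, gibbs ε w a v j * Real.exp (u j / ε)) - ∑ j, u j * w j := by
  rw [semiDual, semiDual, partition_add hw, Real.log_mul (partition_pos hw).ne'
    (sum_gibbs_mul_exp_pos hw _).ne']
  simp only [PiLp.add_apply, add_mul, Finset.sum_add_distrib]
  ring

lemma inner_semiDualGrad : inner ℝ (semiDualGrad ε w a v) u =
    ∑ j, gibbs ε w a v j * u j - ∑ j, u j * w j := by
  rw [inner_eq_sum, ← Finset.sum_sub_distrib]
  exact Finset.sum_congr rfl fun j _ => by simp [semiDualGrad]; ring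

/-- Jensen's inequality for exp under the Gibbs weights; this is convexity in gradient form. -/
lemma semiDual_add_ge [Nonempty (Fin J)] (hε : 0 < ε) (hw : ∀ j, 0 < w j) :
    inner ℝ (semiDualGrad ε w a v) u ≤ semiDual ε w a (v + u) - semiDual ε w a v := by
  rw [semiDual_add hw, inner_semiDualGrad]
  have hs := sum_gibbs (ε := ε) (a := a) (v := v) hw
  have h1 : Real.exp (∑ j, gibbs ε w a v j * (u j / ε)) ≤
      ∑ j, gibbs ε w a v j * Real.exp (u j / ε) := by
    have := convexOn_exp.map_sum_le (t := Finset.univ) (w := gibbs ε w a v)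
      (p := fun j => u j / ε) (fun j _ => (gibbs_pos hw j).le) hs (by simp)
    simpa using this
  have h2 := (Real.le_log_iff_exp_le (sum_gibbs_mul_exp_pos hw _)).2 h1
  have h3 : ∑ j, gibbs ε w a v j * u j = ε * ∑ j, gibbs ε w a v j * (u j / ε) := by
    rw [Finset.mul_sum]
    exact Finset.sum_congr rfl fun j _ => by field_simp
  rw [h3]
  have := mul_le_mul_of_nonneg_left h2 hε.le
  linarith

/-- Center t at its Gibbs mean m and apply `exp_le_add_exp_sq`. As |t_j - m| ≤ 2M, the squared
deviation is at most 4M², whence the constant (not sharp, but any constant serves). -/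
lemma log_sum_gibbs_exp_le [Nonempty (Fin J)] (hw : ∀ j, 0 < w j) {t : Fin J → ℝ} {M : ℝ}
    (ht : ∀ j, |t j| ≤ M) :
    Real.log (∑ j, gibbs ε w a v j * Real.exp (t j)) ≤
      ∑ j, gibbs ε w a v j * t j + 4 * M ^ 2 := by
  have hs := sum_gibbs (ε := ε) (a := a) (v := v) hw
  set p := gibbs ε w a v
  have hp : ∀ j, 0 < p j := gibbs_pos hw
  set m := ∑ j, p j * t j with hm
  have hmM : |m| ≤ M := by
    calc |m| ≤ ∑ j, |p j * t j| := Finset.abs_sum_le_sum_abs _ _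
      _ ≤ ∑ j, p j * M := Finset.sum_le_sum fun j _ => by
          rw [abs_mul, abs_of_pos (hp j)]
          exact mul_le_mul_of_nonneg_left (ht j) (hp j).le
      _ = M := by rw [← Finset.sum_mul, hs, one_mul]
  rw [Real.log_le_iff_le_exp (sum_gibbs_mul_exp_pos hw _), Real.exp_add]
  have h1 : ∑ j, p j * Real.exp (t j) = Real.exp m * ∑ j, p j * Real.exp (t j - m) := by
    rw [Finset.mul_sum]
    refine Finset.sum_congr rfl fun j _ => ?_
    rw [Real.exp_sub]
    field_simp
  rw [h1]
  refine mul_le_mul_of_nonneg_left ?_ (Real.exp_pos _).le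
  have h2 : ∀ j, p j * Real.exp (t j - m) ≤ p j * t j - p j * m + p j * Real.exp (4 * M ^ 2) := by
    intro j
    have h3 : (t j - m) ^ 2 ≤ 4 * M ^ 2 := by
      have h4 : |t j - m| ≤ 2 * M := (abs_sub _ _).trans (by linarith [ht j])
      calc (t j - m) ^ 2 = |t j - m| ^ 2 := (sq_abs _).symm
        _ ≤ (2 * M) ^ 2 := pow_le_pow_left₀ (abs_nonneg _) h4 2
        _ = _ := by ring
    have h5 := (exp_le_add_exp_sq (t j - m)).trans
      (add_le_add_right (Real.exp_le_exp.2 h3) (t j - m))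
    calc p j * Real.exp (t j - m) ≤ p j * (t j - m + Real.exp (4 * M ^ 2)) :=
          mul_le_mul_of_nonneg_left h5 (hp j).le
      _ = _ := by ring
  calc ∑ j, p j * Real.exp (t j - m)
      ≤ ∑ j, (p j * t j - p j * m + p j * Real.exp (4 * M ^ 2)) :=
        Finset.sum_le_sum fun j _ => h2 j
    _ = Real.exp (4 * M ^ 2) := by
        rw [Finset.sum_add_distrib, Finset.sum_sub_distrib, ← Finset.sum_mul, ← Finset.sum_mul, hs]
        linarith

lemma semiDual_add_le [Nonempty (Fin J)] (hε : 0 < ε) (hw : ∀ j, 0 < w j) :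
    semiDual ε w a (v + u) - semiDual ε w a v ≤
      inner ℝ (semiDualGrad ε w a v) u + 4 / ε * ‖u‖ ^ 2 := by
  rw [semiDual_add hw, inner_semiDualGrad]
  have h2 := log_sum_gibbs_exp_le (ε := ε) (a := a) (v := v) hw (t := fun j => u j / ε)
    (M := ‖u‖ / ε) fun j => by
      rw [abs_div, abs_of_pos hε]
      exact div_le_div_of_nonneg_right (abs_apply_le_norm u j) hε.le
  have h3 : ∑ j, gibbs ε w a v j * u j = ε * ∑ j, gibbs ε w a v j * (u j / ε) := by
    rw [Finset.mul_sum]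
    exact Finset.sum_congr rfl fun j _ => by field_simp
  have h4 : 4 / ε * ‖u‖ ^ 2 = ε * (4 * (‖u‖ / ε) ^ 2) := by field_simp
  rw [h3, h4]
  have := mul_le_mul_of_nonneg_left h2 hε.le
  linarith

/-- The convexity and smoothness bounds trap the first-order remainder between 0 and (4/ε)‖u‖², so
differentiability needs no differentiation of the formula. -/
lemma hasGradientAt_semiDual [Nonempty (Fin J)] (hε : 0 < ε) (hw : ∀ j, 0 < w j) :
    HasGradientAt (semiDual ε w a) (semiDualGrad ε w a v) v := by
  rw [hasGradientAt_iff_isLittleO_nhds_zero]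
  have h1 : (fun u => semiDual ε w a (v + u) - semiDual ε w a v
      - inner ℝ (semiDualGrad ε w a v) u) =O[𝓝 0] fun u => ‖u‖ ^ 2 := by
    refine Asymptotics.IsBigO.of_bound (4 / ε) (Eventually.of_forall fun u => ?_)
    have h1 := semiDual_add_ge (a := a) (v := v) (u := u) hε hw
    have h2 := semiDual_add_le (a := a) (v := v) (u := u) hε hw
    rw [Real.norm_of_nonneg (by linarith), Real.norm_of_nonneg (by positivity)]
    linarith
  refine h1.trans_isLittleO ?_
  simpa using (Asymptotics.isLittleO_norm_pow_id (E' := EuclideanSpace ℝ (Fin J)) one_lt_two)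

lemma abs_semiDualGrad_apply_le [Nonempty (Fin J)] (hw : ∀ j, 0 < w j) (hw1 : ∑ j, w j = 1)
    (j : Fin J) : |semiDualGrad ε w a v j| ≤ 1 := by
  have h1 := gibbs_pos (ε := ε) (a := a) (v := v) hw j
  have h2 : gibbs ε w a v j ≤ 1 := le_one_of_sum_eq_one (gibbs_pos hw) (sum_gibbs hw) j
  have h3 := hw j
  have h4 := le_one_of_sum_eq_one hw hw1 j
  simp only [semiDualGrad]
  exact abs_le.2 ⟨by linarith, by linarith⟩

lemma norm_semiDualGrad_le [Nonempty (Fin J)] (hw : ∀ j, 0 < w j) (hw1 : ∑ j, w j = 1) :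
    ‖semiDualGrad ε w a v‖ ≤ √J := by
  simpa using norm_le_sqrt_of_abs_le zero_le_one
    (abs_semiDualGrad_apply_le (ε := ε) (a := a) (v := v) hw hw1)

lemma abs_semiDual_sub_le [Nonempty (Fin J)] (hε : 0 < ε) (hw : ∀ j, 0 < w j)
    (hw1 : ∑ j, w j = 1) (v v' : EuclideanSpace ℝ (Fin J)) :
    |semiDual ε w a v - semiDual ε w a v'| ≤ √J * ‖v - v'‖ := by
  have key : ∀ v v' : EuclideanSpace ℝ (Fin J),
      -(√J * ‖v - v'‖) ≤ semiDual ε w a v - semiDual ε w a v' := fun v v' => by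
    have h1 := semiDual_add_ge (a := a) (v := v') (u := v - v') hε hw
    rw [add_sub_cancel] at h1
    have h2 := (abs_le.1 (abs_real_inner_le_norm (semiDualGrad ε w a v') (v - v'))).1
    have h3 := mul_le_mul_of_nonneg_right
      (norm_semiDualGrad_le (ε := ε) (a := a) (v := v') hw hw1) (norm_nonneg (v - v'))
    linarith
  refine abs_le.2 ⟨key v v', ?_⟩
  have := key v' v
  rw [norm_sub_rev] at this
  linarith

lemma semiDual_add_const [Nonempty (Fin J)] (hε : 0 < ε) (hw : ∀ j, 0 < w j)
    (hw1 : ∑ j, w j = 1) (t : ℝ) :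
    semiDual ε w a (v + WithLp.toLp 2 fun _ => t) = semiDual ε w a v := by
  refine sub_eq_zero.1 ?_
  rw [semiDual_add hw]
  simp only [← Finset.sum_mul, ← Finset.mul_sum, hw1, sum_gibbs hw, one_mul, Real.log_exp]
  field_simp
  simp

/-- Keep a single term of the partition function. This feeds both integrability and coercivity. -/
lemma semiDual_ge [Nonempty (Fin J)] (hε : 0 < ε) (hw : ∀ j, 0 < w j) (j : Fin J) :
    ε + (v j - a j) + ε * Real.log (w j) - ∑ i, v i * w i ≤ semiDual ε w a v := by
  have h1 : Real.exp ((v j - a j) / ε) * w j ≤ partition ε w a v :=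
    Finset.single_le_sum (f := fun j => Real.exp ((v j - a j) / ε) * w j)
      (fun i _ => (mul_pos (Real.exp_pos _) (hw i)).le) (Finset.mem_univ j)
  have h2 := Real.log_le_log (mul_pos (Real.exp_pos _) (hw j)) h1
  rw [Real.log_mul (Real.exp_pos _).ne' (hw j).ne', Real.log_exp] at h2
  have h3 := mul_le_mul_of_nonneg_left h2 hε.le
  rw [mul_add, mul_div_cancel₀ _ hε.ne'] at h3
  rw [semiDual]
  linarith

lemma semiDual_zero_le [Nonempty (Fin J)] (hε : 0 < ε) (hw : ∀ j, 0 < w j)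
    (hw1 : ∑ j, w j = 1) (ha : ∀ j, 0 ≤ a j) : semiDual ε w a 0 ≤ ε := by
  have h1 : partition ε w a 0 ≤ 1 := by
    rw [partition, ← hw1]
    refine Finset.sum_le_sum fun j _ => mul_le_of_le_one_left (hw j).le ?_
    rw [Real.exp_le_one_iff]
    exact div_nonpos_of_nonpos_of_nonneg (by simpa using ha j) hε.le
  have h2 := Real.log_nonpos (partition_pos hw).le h1
  have := mul_nonpos_of_nonneg_of_nonpos hε.le h2
  simp only [semiDual, PiLp.zero_apply, zero_mul, Finset.sum_const_zero]
  linarith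

/-- Add the supporting-hyperplane inequalities at v + u in the directions u and -u. -/
lemma semiDual_midpoint_le [Nonempty (Fin J)] (hε : 0 < ε) (hw : ∀ j, 0 < w j) :
    semiDual ε w a (v + u) ≤
      (semiDual ε w a v + semiDual ε w a (v + (2 : ℝ) • u)) / 2 := by
  have h1 := semiDual_add_ge (a := a) (v := v + u) (u := u) hε hw
  have h2 := semiDual_add_ge (a := a) (v := v + u) (u := -u) hε hw
  rw [inner_neg_right, add_neg_cancel_right] at h2
  rw [add_assoc, ← two_smul ℝ u] at h1
  linarith

/-- Midpoint convexity is strict except along constant directions. -/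
lemma eq_of_semiDual_midpoint_eq [Nonempty (Fin J)] (hε : 0 < ε) (hw : ∀ j, 0 < w j)
    (h : semiDual ε w a (v + u) =
      (semiDual ε w a v + semiDual ε w a (v + (2 : ℝ) • u)) / 2) (i j : Fin J) : u i = u j := by
  have h1 := semiDual_add (ε := ε) (a := a) (v := v) (u := u) hw
  have h2 := semiDual_add (ε := ε) (a := a) (v := v) (u := (2 : ℝ) • u) hw
  have hs := sum_gibbs (ε := ε) (a := a) (v := v) hw
  have hp1 := sum_gibbs_mul_exp_pos (ε := ε) (a := a) (v := v) hw (fun j => u j / ε)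
  have hp2 := sum_gibbs_mul_exp_pos (ε := ε) (a := a) (v := v) hw (fun j => ((2 : ℝ) • u) j / ε)
  have hp := gibbs_pos (ε := ε) (a := a) (v := v) hw
  set p := gibbs ε w a v
  have h3 : ∑ j, ((2 : ℝ) • u) j * w j = 2 * ∑ j, u j * w j := by
    rw [Finset.mul_sum]; exact Finset.sum_congr rfl fun j _ => by simp; ring
  have h4 : Real.log (∑ j, p j * Real.exp (((2 : ℝ) • u) j / ε)) =
      2 * Real.log (∑ j, p j * Real.exp (u j / ε)) := by
    have : ε * Real.log (∑ j, p j * Real.exp (((2 : ℝ) • u) j / ε)) =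
      ε * (2 * Real.log (∑ j, p j * Real.exp (u j / ε))) := by rw [h3] at h2; linarith
    exact mul_left_cancel₀ hε.ne' this
  have h5 : ∑ j, p j * Real.exp (((2 : ℝ) • u) j / ε) =
      (∑ j, p j * Real.exp (u j / ε)) ^ 2 := by
    rw [← Real.exp_log hp2, h4, two_mul, Real.exp_add, Real.exp_log hp1, sq]
  set m := ∑ j, p j * Real.exp (u j / ε) with hm
  -- Equality makes the second moment of exp(u/ε) equal to the square of its mean, so its variance
  -- under the positive Gibbs weights is zero and u is constant.
  have h6 : ∑ j, p j * (Real.exp (u j / ε) - m) ^ 2 = 0 := by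
    have : ∀ j, p j * (Real.exp (u j / ε) - m) ^ 2 =
        p j * Real.exp (((2 : ℝ) • u) j / ε) - 2 * m * (p j * Real.exp (u j / ε)) + m ^ 2 * p j := by
      intro j
      have : Real.exp (((2 : ℝ) • u) j / ε) = Real.exp (u j / ε) ^ 2 := by
        rw [← Real.exp_nat_mul]; congr 1; simp; ring
      rw [this]; ring
    simp only [this, Finset.sum_add_distrib, Finset.sum_sub_distrib, ← Finset.mul_sum, h5, hs]
    rw [← hm]; ring
  have h7 : ∀ j, Real.exp (u j / ε) = m := fun j => by
    have := (Finset.sum_eq_zero_iff_of_nonneg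
      (fun j _ => mul_nonneg (hp j).le (sq_nonneg _))).1 h6 j (Finset.mem_univ j)
    have := (mul_eq_zero.1 this).resolve_left (hp j).ne'
    exact sub_eq_zero.1 (pow_eq_zero_iff two_ne_zero |>.1 this)
  have h8 := Real.exp_injective ((h7 i).trans (h7 j).symm)
  exact (div_left_inj' hε.ne').1 h8

end Gibbs

/-! ### The mean objective: gradient, coercivity, existence and uniqueness of the minimizer -/

section MeanDual

variable {𝒳 : Type*} [MeasurableSpace 𝒳] {J : ℕ}

/-- The semi-dual objective, up to sign. -/
def meanDual (μ : Measure 𝒳) (ε : ℝ) (w : Fin J → ℝ) (a : 𝒳 → Fin J → ℝ)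
    (v : EuclideanSpace ℝ (Fin J)) : ℝ :=
  ∫ x, semiDual ε w (a x) v ∂μ

/-- The gradient of `meanDual`. -/
def meanDualGrad (μ : Measure 𝒳) (ε : ℝ) (w : Fin J → ℝ) (a : 𝒳 → Fin J → ℝ)
    (v : EuclideanSpace ℝ (Fin J)) : EuclideanSpace ℝ (Fin J) :=
  WithLp.toLp 2 fun j => ∫ x, semiDualGrad ε w (a x) v j ∂μ

variable {μ : Measure 𝒳} {ε : ℝ} {w : Fin J → ℝ} {a : 𝒳 → Fin J → ℝ}
  {v u : EuclideanSpace ℝ (Fin J)}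

lemma measurable_partition (ha : Measurable a) :
    Measurable fun p : 𝒳 × EuclideanSpace ℝ (Fin J) => partition ε w (a p.1) p.2 := by
  unfold partition
  fun_prop

lemma measurable_semiDual (ha : Measurable a) :
    Measurable fun p : 𝒳 × EuclideanSpace ℝ (Fin J) => semiDual ε w (a p.1) p.2 := by
  unfold semiDual
  have := measurable_partition (ε := ε) (w := w) ha
  fun_prop

lemma measurable_gibbs (ha : Measurable a) (j : Fin J) :
    Measurable fun p : 𝒳 × EuclideanSpace ℝ (Fin J) => gibbs ε w (a p.1) p.2 j := by
  unfold gibbs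
  have := measurable_partition (ε := ε) (w := w) ha
  fun_prop

lemma measurable_semiDualGrad (ha : Measurable a) :
    Measurable fun p : 𝒳 × EuclideanSpace ℝ (Fin J) => semiDualGrad ε w (a p.1) p.2 := by
  unfold semiDualGrad
  refine (WithLp.measurable_toLp 2 _).comp (measurable_pi_lambda _ fun j => ?_)
  have := measurable_gibbs (ε := ε) (w := w) ha j
  fun_prop

lemma measurable_semiDualGrad_apply (ha : Measurable a) (j : Fin J) :
    Measurable fun p : 𝒳 × EuclideanSpace ℝ (Fin J) => semiDualGrad ε w (a p.1) p.2 j := by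
  have := measurable_gibbs (ε := ε) (w := w) ha j
  unfold semiDualGrad
  fun_prop

lemma measurable_meanDualGrad [SFinite μ] (ha : Measurable a) :
    Measurable (meanDualGrad μ ε w a) := by
  unfold meanDualGrad
  refine (WithLp.measurable_toLp 2 _).comp (measurable_pi_lambda _ fun j => ?_)
  have h1 := measurable_semiDualGrad_apply (ε := ε) (w := w) ha j
  have h2 : StronglyMeasurable (Function.uncurry
      fun (v : EuclideanSpace ℝ (Fin J)) (x : 𝒳) => semiDualGrad ε w (a x) v j) :=
    (h1.comp measurable_swap).stronglyMeasurable
  exact (h2.integral_prod_right (ν := μ)).measurable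

/-- Standing assumptions on the weights and on the costs. -/
structure Admissible (μ : Measure 𝒳) (ε : ℝ) (w : Fin J → ℝ) (a : 𝒳 → Fin J → ℝ) : Prop where
  eps_pos : 0 < ε
  weight_pos : ∀ j, 0 < w j
  weight_sum : ∑ j, w j = 1
  measurable : Measurable a
  nonneg : ∀ x j, 0 ≤ a x j
  integrable : ∀ j, Integrable (fun x => a x j) μ

lemma Admissible.nonempty (hA : Admissible μ ε w a) : Nonempty (Fin J) :=
  nonempty_of_sum_eq_one hA.weight_sum

variable [IsProbabilityMeasure μ]

lemma integrable_semiDualGrad_apply (hw : ∀ j, 0 < w j) (hw1 : ∑ j, w j = 1)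
    (ha : Measurable a) (v : EuclideanSpace ℝ (Fin J)) (j : Fin J) :
    Integrable (fun x => semiDualGrad ε w (a x) v j) μ := by
  have := nonempty_of_sum_eq_one hw1
  have hm : Measurable fun x => semiDualGrad ε w (a x) v j :=
    Measurable.comp (g := fun p : 𝒳 × EuclideanSpace ℝ (Fin J) => semiDualGrad ε w (a p.1) p.2 j)
      (f := fun x => (x, v)) (measurable_semiDualGrad_apply ha j) (by fun_prop)
  exact Integrable.of_bound hm.aestronglyMeasurable 1
    (Eventually.of_forall fun x => abs_semiDualGrad_apply_le hw hw1 j)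

lemma integrable_inner_semiDualGrad (hw : ∀ j, 0 < w j) (hw1 : ∑ j, w j = 1)
    (ha : Measurable a) (v u : EuclideanSpace ℝ (Fin J)) :
    Integrable (fun x => inner ℝ (semiDualGrad ε w (a x) v) u) μ := by
  simp only [inner_eq_sum]
  exact integrable_finsetSum _ fun j _ =>
    (integrable_semiDualGrad_apply hw hw1 ha v j).mul_const _

lemma integral_inner_semiDualGrad (hw : ∀ j, 0 < w j) (hw1 : ∑ j, w j = 1)
    (ha : Measurable a) (v u : EuclideanSpace ℝ (Fin J)) :
    ∫ x, inner ℝ (semiDualGrad ε w (a x) v) u ∂μ = inner ℝ (meanDualGrad μ ε w a v) u := by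
  simp only [inner_eq_sum]
  rw [integral_finsetSum _ fun j _ =>
    (integrable_semiDualGrad_apply hw hw1 ha v j).mul_const _]
  simp only [integral_mul_const, meanDualGrad]

/-- The orthogonal projection onto the vectors of sum zero. -/
def center (v : EuclideanSpace ℝ (Fin J)) : EuclideanSpace ℝ (Fin J) :=
  v + WithLp.toLp 2 fun _ => -((∑ i, v i) / J)

lemma sum_center [Nonempty (Fin J)] (v : EuclideanSpace ℝ (Fin J)) :
    ∑ j, center v j = 0 := by
  have hJ : (J : ℝ) ≠ 0 := by
    have := Fin.pos (Classical.arbitrary (Fin J))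
    exact_mod_cast this.ne'
  simp [center, Finset.sum_add_distrib]
  field_simp
  simp

namespace Admissible

lemma integrable_semiDual (hA : Admissible μ ε w a)
    (v : EuclideanSpace ℝ (Fin J)) : Integrable (fun x => semiDual ε w (a x) v) μ := by
  obtain ⟨hε, hw, hw1, ha, ha0, hai⟩ := hA
  have := nonempty_of_sum_eq_one hw1
  obtain ⟨j⟩ := nonempty_of_sum_eq_one hw1
  have hm : ∀ v, AEStronglyMeasurable (fun x => semiDual ε w (a x) v) μ := fun v =>
    ((measurable_semiDual ha).comp measurable_prodMk_right).aestronglyMeasurable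
  refine Integrable.mono' (g := fun x => (a x j + |ε + ε * Real.log (w j)| + ε) + √J * ‖v‖)
    ((((hai j).add (integrable_const _)).add (integrable_const _)).add (integrable_const _))
    (hm v) (Eventually.of_forall fun x => ?_)
  have h1 := abs_semiDual_sub_le (a := a x) hε hw hw1 v 0
  rw [sub_zero] at h1
  have h2 := semiDual_zero_le hε hw hw1 (ha0 x)
  have h3 := semiDual_ge (a := a x) (v := 0) hε hw j
  simp only [PiLp.zero_apply, zero_mul, Finset.sum_const_zero] at h3
  have h4 := neg_abs_le (ε + ε * Real.log (w j))
  have h5 := abs_nonneg (ε + ε * Real.log (w j))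
  have h6 := ha0 x j
  rw [Real.norm_eq_abs]
  have h7 := abs_le.1 h1
  exact abs_le.2 ⟨by linarith, by linarith⟩


lemma meanDual_add_ge (hA : Admissible μ ε w a) (v u : EuclideanSpace ℝ (Fin J)) :
    inner ℝ (meanDualGrad μ ε w a v) u ≤ meanDual μ ε w a (v + u) - meanDual μ ε w a v := by
  have := hA.nonempty
  rw [meanDual, meanDual, ← integral_sub (hA.integrable_semiDual _) (hA.integrable_semiDual _),
    ← integral_inner_semiDualGrad hA.weight_pos hA.weight_sum hA.measurable]
  exact integral_mono
    (integrable_inner_semiDualGrad hA.weight_pos hA.weight_sum hA.measurable v u)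
    ((hA.integrable_semiDual _).sub (hA.integrable_semiDual _))
    fun x => semiDual_add_ge hA.eps_pos hA.weight_pos

lemma meanDual_add_le (hA : Admissible μ ε w a) (v u : EuclideanSpace ℝ (Fin J)) :
    meanDual μ ε w a (v + u) - meanDual μ ε w a v ≤
      inner ℝ (meanDualGrad μ ε w a v) u + 4 / ε * ‖u‖ ^ 2 := by
  have := hA.nonempty
  have hi := integrable_inner_semiDualGrad (ε := ε) (μ := μ) hA.weight_pos hA.weight_sum
    hA.measurable v u
  have h1 : ∫ x, (inner ℝ (semiDualGrad ε w (a x) v) u + 4 / ε * ‖u‖ ^ 2) ∂μ =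
      inner ℝ (meanDualGrad μ ε w a v) u + 4 / ε * ‖u‖ ^ 2 := by
    rw [integral_add hi (integrable_const _),
      integral_inner_semiDualGrad hA.weight_pos hA.weight_sum hA.measurable]
    simp
  rw [meanDual, meanDual, ← integral_sub (hA.integrable_semiDual _) (hA.integrable_semiDual _),
    ← h1]
  exact integral_mono ((hA.integrable_semiDual _).sub (hA.integrable_semiDual _))
    (hi.add (integrable_const _)) fun x => semiDual_add_le hA.eps_pos hA.weight_pos

lemma norm_meanDualGrad_le (hA : Admissible μ ε w a) (v : EuclideanSpace ℝ (Fin J)) :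
    ‖meanDualGrad μ ε w a v‖ ≤ √J := by
  have := hA.nonempty
  have key : ∀ j, |meanDualGrad μ ε w a v j| ≤ 1 := fun j => by
    have := norm_integral_le_of_norm_le_const (μ := μ)
      (f := fun x => semiDualGrad ε w (a x) v j) (C := 1)
      (Eventually.of_forall fun x => abs_semiDualGrad_apply_le hA.weight_pos hA.weight_sum j)
    simpa [meanDualGrad] using this
  simpa using norm_le_sqrt_of_abs_le zero_le_one key

lemma abs_meanDual_sub_le (hA : Admissible μ ε w a) (v v' : EuclideanSpace ℝ (Fin J)) :
    |meanDual μ ε w a v - meanDual μ ε w a v'| ≤ √J * ‖v - v'‖ := by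
  have := hA.nonempty
  rw [meanDual, meanDual, ← integral_sub (hA.integrable_semiDual _) (hA.integrable_semiDual _)]
  have := norm_integral_le_of_norm_le_const (μ := μ)
    (f := fun x => semiDual ε w (a x) v - semiDual ε w (a x) v') (C := √J * ‖v - v'‖)
    (Eventually.of_forall fun x =>
      abs_semiDual_sub_le hA.eps_pos hA.weight_pos hA.weight_sum v v')
  simpa using this

lemma continuous_meanDual (hA : Admissible μ ε w a) : Continuous (meanDual μ ε w a) := by
  refine (LipschitzWith.of_dist_le_mul (K := ⟨√J, Real.sqrt_nonneg _⟩) fun v v' => ?_).continuous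
  rw [Real.dist_eq, dist_eq_norm]
  exact hA.abs_meanDual_sub_le v v'

lemma meanDual_add_const (hA : Admissible μ ε w a) (v : EuclideanSpace ℝ (Fin J)) (t : ℝ) :
    meanDual μ ε w a (v + WithLp.toLp 2 fun _ => t) = meanDual μ ε w a v := by
  have := hA.nonempty
  simp only [meanDual, semiDual_add_const hA.eps_pos hA.weight_pos hA.weight_sum]

lemma meanDual_ge (hA : Admissible μ ε w a) (v : EuclideanSpace ℝ (Fin J)) (j : Fin J) :
    v j - ∑ i, v i * w i + (ε + ε * Real.log (w j) - ∫ x, a x j ∂μ) ≤ meanDual μ ε w a v := by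
  have := hA.nonempty
  have h1 : ∫ x, ((v j - ∑ i, v i * w i + (ε + ε * Real.log (w j))) - a x j) ∂μ ≤
      meanDual μ ε w a v :=
    integral_mono ((integrable_const _).sub (hA.integrable j)) (hA.integrable_semiDual v)
      fun x => by
        have := semiDual_ge (a := a x) (v := v) hA.eps_pos hA.weight_pos j
        simp only
        linarith
  rw [integral_sub (integrable_const _) (hA.integrable j)] at h1
  simp at h1
  linarith

/-- Sublevel sets of the objective are bounded in the hyperplane of vectors of sum zero. -/
lemma exists_norm_le_of_meanDual_le (hA : Admissible μ ε w a) (B : ℝ) :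
    ∃ R, ∀ v : EuclideanSpace ℝ (Fin J), ∑ j, v j = 0 → meanDual μ ε w a v ≤ B → ‖v‖ ≤ R := by
  have := hA.nonempty
  obtain ⟨j₀, hj₀⟩ := Finite.exists_min w
  obtain ⟨C, hC⟩ : ∃ C, ∀ j, B - (ε + ε * Real.log (w j) - ∫ x, a x j ∂μ) ≤ C := by
    obtain ⟨k, hk⟩ := Finite.exists_max fun j => B - (ε + ε * Real.log (w j) - ∫ x, a x j ∂μ)
    exact ⟨_, hk⟩
  refine ⟨√J * (2 * (C / w j₀)), fun v hv0 hvB => ?_⟩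
  set m := ∑ i, v i * w i with hm
  -- `meanDual_ge` only bounds the deviations v_j - m from above. Their w-average is zero, so large
  -- negative deviations are excluded too, at the cost of the factor 1 / min w.
  have h1 : ∀ j, v j - m ≤ C := fun j => by linarith [hA.meanDual_ge v j, hC j]
  have hsum : ∑ i, w i * (v i - m) = 0 := by
    simp only [mul_sub, Finset.sum_sub_distrib, ← Finset.sum_mul, hA.weight_sum]
    rw [hm]
    simp [mul_comm]
  have hC0 : 0 ≤ C := by
    by_contra! hC0
    have : ∑ i, w i * (v i - m) < 0 := Finset.sum_neg
      (fun i _ => mul_neg_of_pos_of_neg (hA.weight_pos i) ((h1 i).trans_lt hC0))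
      Finset.univ_nonempty
    linarith
  have hw0 := hA.weight_pos j₀
  have h2 : ∀ j, m - v j ≤ C / w j₀ := fun j => by
    have h3 : ∑ i, w i * (C - (v i - m)) = C := by
      calc ∑ i, w i * (C - (v i - m)) = (∑ i, w i) * C - ∑ i, w i * (v i - m) := by
            rw [Finset.sum_mul, ← Finset.sum_sub_distrib]
            exact Finset.sum_congr rfl fun i _ => by ring
        _ = C := by rw [hsum, hA.weight_sum]; ring
    have h4 : w j * (C - (v j - m)) ≤ C := by
      conv_rhs => rw [← h3]
      exact Finset.single_le_sum (f := fun i => w i * (C - (v i - m)))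
        (fun i _ => mul_nonneg (hA.weight_pos i).le (by linarith [h1 i])) (Finset.mem_univ j)
    have h5 : w j₀ * (C - (v j - m)) ≤ C :=
      (mul_le_mul_of_nonneg_right (hj₀ j) (by linarith [h1 j])).trans h4
    rw [le_div_iff₀ hw0]
    nlinarith
  have hCw : C ≤ C / w j₀ :=
    le_div_self hC0 hw0 (le_one_of_sum_eq_one hA.weight_pos hA.weight_sum j₀)
  have h3 : ∀ j, |v j - m| ≤ C / w j₀ := fun j =>
    abs_le.2 ⟨by linarith [h2 j], by linarith [h1 j]⟩
  have hJ : (0 : ℝ) < J := by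
    have := Fin.pos (Classical.arbitrary (Fin J))
    exact_mod_cast this
  have h4 : |m| ≤ C / w j₀ := by
    have h5 : ∑ j, (v j - m) = -(J * m) := by simp [Finset.sum_sub_distrib, hv0]
    have h6 : |∑ j, (v j - m)| ≤ J * (C / w j₀) :=
      (Finset.abs_sum_le_sum_abs _ _).trans
        ((Finset.sum_le_sum fun j _ => h3 j).trans (by simp))
    rw [h5, abs_neg, abs_mul, abs_of_pos hJ] at h6
    exact le_of_mul_le_mul_left h6 hJ
  refine norm_le_sqrt_of_abs_le (by positivity) fun j => ?_
  calc |v j| = |(v j - m) + m| := by ring_nf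
    _ ≤ |v j - m| + |m| := abs_add_le _ _
    _ ≤ _ := by linarith [h3 j]

lemma meanDual_center (hA : Admissible μ ε w a) (v : EuclideanSpace ℝ (Fin J)) :
    meanDual μ ε w a (center v) = meanDual μ ε w a v :=
  hA.meanDual_add_const v _

/-- Invariance under constants allows restriction to the sum-zero hyperplane, where the sublevel set
of H(0) lies in a compact ball. -/
lemma exists_minimizer (hA : Admissible μ ε w a) :
    ∃ v : EuclideanSpace ℝ (Fin J), ∑ j, v j = 0 ∧
      ∀ v', meanDual μ ε w a v ≤ meanDual μ ε w a v' := by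
  have := hA.nonempty
  obtain ⟨R, hR⟩ := hA.exists_norm_le_of_meanDual_le (meanDual μ ε w a 0)
  set K : Set (EuclideanSpace ℝ (Fin J)) := {v | ∑ j, v j = 0} ∩ Metric.closedBall 0 R
  have hK : IsCompact K := (isCompact_closedBall 0 R).inter_left
    (isClosed_eq (by fun_prop) continuous_const)
  have h0 : (0 : EuclideanSpace ℝ (Fin J)) ∈ K :=
    ⟨by simp, by simpa using hR 0 (by simp) le_rfl⟩
  obtain ⟨v, hv, hmin⟩ := hK.exists_isMinOn ⟨0, h0⟩ hA.continuous_meanDual.continuousOn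
  refine ⟨v, hv.1, fun v' => ?_⟩
  rw [← hA.meanDual_center v']
  rcases le_total (meanDual μ ε w a (center v')) (meanDual μ ε w a 0) with h | h
  · exact hmin ⟨sum_center v', by simpa using hR _ (sum_center v') h⟩
  · exact (hmin h0).trans h

lemma meanDualGrad_eq_zero (hA : Admissible μ ε w a)
    (hv : ∀ v', meanDual μ ε w a v ≤ meanDual μ ε w a v') : meanDualGrad μ ε w a v = 0 := by
  set g := meanDualGrad μ ε w a v with hg
  have hε := hA.eps_pos
  -- The step ε/8 minimizes -s‖g‖² + (4/ε) s²‖g‖²; the guaranteed decrease is (ε/16)‖g‖².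
  have h1 := hA.meanDual_add_le v (-((ε / 8) • g))
  have h2 := hv (v + -((ε / 8) • g))
  rw [← hg, inner_neg_right, real_inner_smul_right, real_inner_self_eq_norm_sq, norm_neg,
    norm_smul, Real.norm_of_nonneg (by positivity)] at h1
  have h3 : 4 / ε * (ε / 8 * ‖g‖) ^ 2 = ε / 16 * ‖g‖ ^ 2 := by field_simp; ring
  rw [h3] at h1
  have h4 : ε / 16 * ‖g‖ ^ 2 ≤ 0 := by linarith
  have h5 : ‖g‖ ^ 2 ≤ 0 := nonpos_of_mul_nonpos_right h4 (by positivity)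
  have h6 : ‖g‖ = 0 := by
    have := sq_nonneg ‖g‖
    exact pow_eq_zero_iff two_ne_zero |>.1 (le_antisymm h5 this)
  exact norm_eq_zero.1 h6

/-- The midpoint convexity defect is nonnegative pointwise and has integral at most 0, so it
vanishes almost everywhere. A single such x forces v' - v to be a constant vector, and sum zero
makes it 0. -/
lemma minimizer_unique (hA : Admissible μ ε w a) {v v' : EuclideanSpace ℝ (Fin J)}
    (h0 : ∑ j, v j = 0) (h0' : ∑ j, v' j = 0)
    (hv : ∀ z, meanDual μ ε w a v ≤ meanDual μ ε w a z)
    (hv' : meanDual μ ε w a v' = meanDual μ ε w a v) : v' = v := by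
  have := hA.nonempty
  set u := (2⁻¹ : ℝ) • (v' - v) with hu
  have hvu : v + (2 : ℝ) • u = v' := by rw [hu, smul_smul]; norm_num
  have hi := hA.integrable_semiDual
  have hi2 : Integrable
      (fun x => (semiDual ε w (a x) v + semiDual ε w (a x) (v + (2 : ℝ) • u)) / 2) μ :=
    ((hi _).add (hi _)).div_const 2
  have h1 : ∫ x, ((semiDual ε w (a x) v + semiDual ε w (a x) (v + (2 : ℝ) • u)) / 2
      - semiDual ε w (a x) (v + u)) ∂μ ≤ 0 := by
    rw [integral_sub hi2 (hi _), integral_div,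
      integral_add (hi _) (hi _)]
    change (meanDual μ ε w a v + meanDual μ ε w a (v + (2 : ℝ) • u)) / 2
      - meanDual μ ε w a (v + u) ≤ 0
    rw [hvu]
    linarith [hv (v + u)]
  have h2 : 0 ≤ fun x => (semiDual ε w (a x) v + semiDual ε w (a x) (v + (2 : ℝ) • u)) / 2
      - semiDual ε w (a x) (v + u) := fun x => by
    have := semiDual_midpoint_le (a := a x) (v := v) (u := u) hA.eps_pos hA.weight_pos
    simp only [Pi.zero_apply]
    linarith
  have h3 := (integral_eq_zero_iff_of_nonneg h2
    (hi2.sub (hi _))).1 (le_antisymm h1 (integral_nonneg h2))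
  obtain ⟨x, hx⟩ := h3.exists
  simp only [Pi.zero_apply] at hx
  have h4 := eq_of_semiDual_midpoint_eq (a := a x) (v := v) (u := u) hA.eps_pos hA.weight_pos
    (by linarith)
  have h5 : ∑ j, u j = 0 := by
    simp [hu, ← Finset.mul_sum, Finset.sum_sub_distrib, h0, h0']
  have h6 : u = 0 := by
    ext i
    have h7 : ∑ j, u j = J * u i := by
      rw [Finset.sum_congr rfl fun j _ => h4 j i]; simp
    have hJ : (J : ℝ) ≠ 0 := by exact_mod_cast (Fin.pos i).ne'
    rw [h5] at h7
    simpa [hJ] using h7.symm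
  rw [← hvu, h6]
  simp

end Admissible

end MeanDual

/-! ### Entropic duality and the Gibbs coupling -/

section Duality

/-- The Gibbs variational inequality: `∫ T dπ ≤ ∫ log (dπ/dξ) dπ` if `∫ exp T dξ ≤ 1`. -/
lemma integral_le_integral_log_rnDeriv {Z : Type*} [MeasurableSpace Z] {π ξ : Measure Z}
    [IsProbabilityMeasure π] [IsProbabilityMeasure ξ] (hac : π ≪ ξ) {T : Z → ℝ}
    (hT : Measurable T) (hTi : Integrable T π)
    (hlog : Integrable (fun z => Real.log (π.rnDeriv ξ z).toReal) π)
    (hexp : ∫⁻ z, ENNReal.ofReal (Real.exp (T z)) ∂ξ ≤ 1) :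
    ∫ z, T z ∂π ≤ ∫ z, Real.log (π.rnDeriv ξ z).toReal ∂π := by
  set r : Z → ℝ := fun z => (π.rnDeriv ξ z).toReal with hr
  have hrm : Measurable r := (Measure.measurable_rnDeriv π ξ).ennreal_toReal
  set f : Z → ℝ := fun z => Real.exp (T z) / r z with hf
  have hfm : Measurable f := hT.exp.div hrm
  have hf0 : ∀ z, 0 ≤ f z := fun z => div_nonneg (Real.exp_pos _).le ENNReal.toReal_nonneg
  have h1 : ∫⁻ z, ENNReal.ofReal (f z) ∂π ≤ 1 := by
    rw [← lintegral_rnDeriv_mul hac hfm.ennreal_ofReal.aemeasurable]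
    refine le_trans (lintegral_mono_ae ?_) hexp
    filter_upwards [Measure.rnDeriv_lt_top π ξ] with z hz
    rw [← ENNReal.ofReal_toReal hz.ne, ← ENNReal.ofReal_mul ENNReal.toReal_nonneg]
    -- Only an inequality holds: where the density r vanishes, division by zero makes f zero while
    -- exp T is positive.
    refine ENNReal.ofReal_le_ofReal ?_
    change r z * (Real.exp (T z) / r z) ≤ _
    rcases eq_or_ne (r z) 0 with h | h
    · rw [h, zero_mul]; exact (Real.exp_pos _).le
    · rw [mul_div_cancel₀ _ h]
  have hfi : Integrable f π := by
    refine ⟨hfm.aestronglyMeasurable, ?_⟩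
    rw [hasFiniteIntegral_iff_ofReal (Eventually.of_forall hf0)]
    exact h1.trans_lt ENNReal.one_lt_top
  have h2 : ∫ z, f z ∂π ≤ 1 := by
    rw [integral_eq_lintegral_of_nonneg_ae (Eventually.of_forall hf0) hfm.aestronglyMeasurable]
    exact ENNReal.toReal_le_of_le_ofReal zero_le_one (by simpa using h1)
  have h3 : ∫ z, (T z - Real.log (r z)) ∂π ≤ ∫ z, (f z - 1) ∂π := by
    refine integral_mono_ae (hTi.sub hlog) (hfi.sub (integrable_const _)) ?_
    filter_upwards [Measure.rnDeriv_pos hac, hac.ae_le (Measure.rnDeriv_lt_top π ξ)] with z hz0 hz1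
    have hz : 0 < r z := ENNReal.toReal_pos hz0.ne' hz1.ne
    -- The pointwise bound s ≤ exp s - 1 at s = T - log r, valid π-almost everywhere since r > 0
    -- there, replaces Jensen.
    have := Real.add_one_le_exp (T z - Real.log (r z))
    rw [Real.exp_sub, Real.exp_log hz] at this
    simp only [hf]
    linarith
  rw [integral_sub hTi hlog, integral_sub hfi (integrable_const _)] at h3
  simp at h3
  linarith

variable {𝒳 𝒴 : Type*} [MeasurableSpace 𝒳] [MeasurableSpace 𝒴] {J : ℕ}
  {y : Fin J → 𝒴} {w : Fin J → ℝ}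

lemma isProbabilityMeasure_discreteMeasure (y : Fin J → 𝒴) (hw : ∀ j, 0 < w j)
    (hw1 : ∑ j, w j = 1) : IsProbabilityMeasure (discreteMeasure y w) := by
  refine ⟨?_⟩
  simp only [discreteMeasure, Measure.coe_finsetSum, Finset.sum_apply, Measure.smul_apply,
    measure_univ, smul_eq_mul, mul_one]
  rw [← ENNReal.ofReal_sum_of_nonneg fun j _ => (hw j).le, hw1, ENNReal.ofReal_one]

lemma lintegral_discreteMeasure (y : Fin J → 𝒴) (w : Fin J → ℝ) {g : 𝒴 → ENNReal}
    (hg : Measurable g) :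
    ∫⁻ t, g t ∂(discreteMeasure y w) = ∑ j, ENNReal.ofReal (w j) * g (y j) := by
  simp [discreteMeasure, lintegral_dirac' _ hg]

lemma isProbabilityMeasure_of_mem_couplings {μ : Measure 𝒳} {ν : Measure 𝒴}
    [IsProbabilityMeasure μ] {π : Measure (𝒳 × 𝒴)} (hπ : π ∈ couplings μ ν) :
    IsProbabilityMeasure π := by
  refine ⟨?_⟩
  rw [← Measure.fst_univ, hπ.1, measure_univ]

/-- The function on `𝒳 × 𝒴` given by `f j` on the slice over `y j`, and zero elsewhere. -/
def extend (y : Fin J → 𝒴) (f : 𝒳 → Fin J → ℝ) (z : 𝒳 × 𝒴) : ℝ :=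
  ∑ j, ({y j} : Set 𝒴).indicator (fun _ => f z.1 j) z.2

lemma extend_apply (hy : Function.Injective y) (f : 𝒳 → Fin J → ℝ) (x : 𝒳) (j : Fin J) :
    extend y f (x, y j) = f x j := by
  rw [extend, Finset.sum_eq_single j]
  · simp
  · intro i _ hij
    simp [hy.ne hij.symm]
  · simp

lemma abs_extend_le (f : 𝒳 → Fin J → ℝ) (z : 𝒳 × 𝒴) : |extend y f z| ≤ ∑ j, |f z.1 j| := by
  refine (Finset.abs_sum_le_sum_abs _ _).trans (Finset.sum_le_sum fun j _ => ?_)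
  by_cases h : z.2 = y j <;> simp [h]

variable [MeasurableSingletonClass 𝒴]

lemma measurable_extend (y : Fin J → 𝒴) {f : 𝒳 → Fin J → ℝ} (hf : Measurable f) :
    Measurable (extend y f) := by
  refine Finset.measurable_sum _ fun j _ => ?_
  have : (fun z : 𝒳 × 𝒴 => ({y j} : Set 𝒴).indicator (fun _ => f z.1 j) z.2) =
      (Prod.snd ⁻¹' {y j}).indicator fun z : 𝒳 × 𝒴 => f z.1 j := rfl
  rw [this]
  exact Measurable.indicator (by fun_prop) (measurable_snd (measurableSet_singleton _))

lemma ae_mem_range_discreteMeasure (y : Fin J → 𝒴) (w : Fin J → ℝ) :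
    ∀ᵐ t ∂(discreteMeasure y w), t ∈ Set.range y := by
  have hm : MeasurableSet (Set.range y) := (Set.finite_range y).measurableSet
  rw [ae_iff]
  change discreteMeasure y w (Set.range y)ᶜ = 0
  simp [discreteMeasure, hm]

lemma ae_snd_mem_range {μ : Measure 𝒳} {π : Measure (𝒳 × 𝒴)}
    (hπ : π ∈ couplings μ (discreteMeasure y w)) : ∀ᵐ z ∂π, z.2 ∈ Set.range y := by
  have h := ae_mem_range_discreteMeasure y w
  rw [← hπ.2] at h
  exact ae_of_ae_map measurable_snd.aemeasurable h

lemma ae_eq_extend {μ : Measure 𝒳} {π : Measure (𝒳 × 𝒴)} (hy : Function.Injective y)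
    (hπ : π ∈ couplings μ (discreteMeasure y w)) (c : 𝒳 × 𝒴 → ℝ) :
    ∀ᵐ z ∂π, c z = extend y (fun x j => c (x, y j)) z := by
  filter_upwards [ae_snd_mem_range hπ] with z hz
  obtain ⟨j, hj⟩ := hz
  obtain ⟨x, t⟩ := z
  simp only at hj
  rw [← hj, extend_apply hy]

lemma integrable_comp_fst {μ : Measure 𝒳} {ν : Measure 𝒴} {π : Measure (𝒳 × 𝒴)}
    (hπ : π ∈ couplings μ ν) {f : 𝒳 → ℝ} (hf : Integrable f μ) :
    Integrable (fun z => f z.1) π := by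
  rw [← hπ.1] at hf
  exact hf.comp_measurable measurable_fst

lemma integral_comp_fst {μ : Measure 𝒳} {ν : Measure 𝒴} {π : Measure (𝒳 × 𝒴)}
    (hπ : π ∈ couplings μ ν) {f : 𝒳 → ℝ} (hf : Integrable f μ) :
    ∫ z, f z.1 ∂π = ∫ x, f x ∂μ := by
  rw [← hπ.1] at hf ⊢
  exact (integral_map measurable_fst.aemeasurable hf.aestronglyMeasurable).symm

lemma integrable_extend {μ : Measure 𝒳} {π : Measure (𝒳 × 𝒴)}
    (hπ : π ∈ couplings μ (discreteMeasure y w)) {f : 𝒳 → Fin J → ℝ} (hf : Measurable f)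
    (hfi : ∀ j, Integrable (fun x => f x j) μ) : Integrable (extend y f) π :=
  Integrable.mono' (g := fun z => ∑ j, |f z.1 j|)
    (integrable_finsetSum _ fun j _ => (integrable_comp_fst hπ (hfi j)).abs)
    (measurable_extend y hf).aestronglyMeasurable
    (Eventually.of_forall fun z => abs_extend_le f z)

lemma integral_extend_const {μ : Measure 𝒳} [IsProbabilityMeasure μ] {π : Measure (𝒳 × 𝒴)}
    (hw : ∀ j, 0 < w j) (hy : Function.Injective y)
    (hπ : π ∈ couplings μ (discreteMeasure y w)) (b : Fin J → ℝ) :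
    ∫ z, extend y (fun _ => b) z ∂π = ∑ j, b j * w j := by
  have : IsProbabilityMeasure π := isProbabilityMeasure_of_mem_couplings hπ
  have hm : ∀ j, MeasurableSet ((Prod.snd : 𝒳 × 𝒴 → 𝒴) ⁻¹' {y j}) := fun j =>
    measurable_snd (measurableSet_singleton _)
  have h1 : extend y (fun _ : 𝒳 => b) = fun z : 𝒳 × 𝒴 =>
      ∑ j, (Prod.snd ⁻¹' {y j}).indicator (fun _ => b j) z := rfl
  rw [h1, integral_finsetSum _ fun j _ => (integrable_const _).indicator (hm j)]
  refine Finset.sum_congr rfl fun j _ => ?_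
  rw [integral_indicator_const _ (hm j), smul_eq_mul, mul_comm]
  congr 1
  rw [measureReal_def, ← Measure.snd_apply (measurableSet_singleton _), hπ.2]
  simp only [discreteMeasure, Measure.coe_finsetSum, Finset.sum_apply, Measure.smul_apply,
    smul_eq_mul, Measure.dirac_apply' _ (measurableSet_singleton _)]
  rw [Finset.sum_eq_single j]
  · simp [(hw j).le]
  · intro i _ hij
    simp [hy.ne hij]
  · simp

/-- The logarithm of the density of the Gibbs coupling. -/
def logDensity (ε : ℝ) (w : Fin J → ℝ) (v : EuclideanSpace ℝ (Fin J)) (a : Fin J → ℝ)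
    (j : Fin J) : ℝ :=
  (v j - a j - semiDual ε w a v + ε - ∑ i, v i * w i) / ε

lemma exp_logDensity {ε : ℝ} [Nonempty (Fin J)] (hε : 0 < ε) (hw : ∀ j, 0 < w j)
    (v : EuclideanSpace ℝ (Fin J)) (a : Fin J → ℝ) (j : Fin J) :
    Real.exp (logDensity ε w v a j) = gibbs ε w a v j / w j := by
  have h1 : logDensity ε w v a j = (v j - a j) / ε - Real.log (partition ε w a v) := by
    rw [logDensity, semiDual]
    field_simp
    ring
  rw [h1, Real.exp_sub, Real.exp_log (partition_pos hw), gibbs]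
  have := (hw j).ne'
  field_simp

variable {μ : Measure 𝒳} [IsProbabilityMeasure μ] {ε : ℝ} {a : 𝒳 → Fin J → ℝ}

lemma measurable_logDensity (ha : Measurable a) (v : EuclideanSpace ℝ (Fin J)) :
    Measurable fun x => logDensity ε w v (a x) := by
  have h : Measurable fun x => semiDual ε w (a x) v :=
    Measurable.comp (g := fun p : 𝒳 × EuclideanSpace ℝ (Fin J) => semiDual ε w (a p.1) p.2)
      (f := fun x => (x, v)) (measurable_semiDual ha) (by fun_prop)
  refine measurable_pi_lambda _ fun j => ?_
  unfold logDensity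
  fun_prop

lemma integrable_logDensity (hA : Admissible μ ε w a) (v : EuclideanSpace ℝ (Fin J))
    (j : Fin J) : Integrable (fun x => logDensity ε w v (a x) j) μ :=
  (((((integrable_const _).sub (hA.integrable j)).sub (hA.integrable_semiDual v)).add
    (integrable_const _)).sub (integrable_const _)).div_const _

/-- The second marginal evaluates the v-part and the first marginal the normalization, so the answer
depends on π only through its mean cost. Weak and strong duality both rest on this identity; its
term ε cancels the -1 inside KL. -/
lemma integral_extend_logDensity (hA : Admissible μ ε w a) (hy : Function.Injective y)
    (v : EuclideanSpace ℝ (Fin J)) {π : Measure (𝒳 × 𝒴)}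
    (hπ : π ∈ couplings μ (discreteMeasure y w)) :
    ε * ∫ z, extend y (fun x => logDensity ε w v (a x)) z ∂π =
      ε - ∫ z, extend y a z ∂π - meanDual μ ε w a v := by
  have : IsProbabilityMeasure π := isProbabilityMeasure_of_mem_couplings hπ
  have i1 : Integrable (extend y fun _ : 𝒳 => (v : Fin J → ℝ)) π :=
    integrable_extend hπ measurable_const fun j => integrable_const _
  have i2 : Integrable (extend y a) π := integrable_extend hπ hA.measurable hA.integrable
  have i3 : Integrable (fun z => semiDual ε w (a z.1) v) π :=
    integrable_comp_fst hπ (hA.integrable_semiDual v)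
  have h1 : ∫ z, ε * extend y (fun x => logDensity ε w v (a x)) z ∂π =
      ∫ z, (extend y (fun _ => (v : Fin J → ℝ)) z - extend y a z - semiDual ε w (a z.1) v
        + (ε - ∑ i, v i * w i)) ∂π := by
    refine integral_congr_ae ?_
    filter_upwards [ae_snd_mem_range hπ] with z hz
    obtain ⟨j, hj⟩ := hz
    obtain ⟨x, t⟩ := z
    simp only at hj
    rw [← hj]
    simp only [extend_apply hy]
    rw [logDensity, mul_div_cancel₀ _ hA.eps_pos.ne']
    ring
  have i12 : Integrable (fun z => extend y (fun _ : 𝒳 => (v : Fin J → ℝ)) z - extend y a z) π :=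
    i1.sub i2
  have i123 : Integrable (fun z => extend y (fun _ : 𝒳 => (v : Fin J → ℝ)) z - extend y a z
    - semiDual ε w (a z.1) v) π := i12.sub i3
  rw [← integral_const_mul, h1, integral_add i123 (integrable_const _), integral_sub i12 i3, integral_sub i1 i2, integral_extend_const hA.weight_pos hy hπ,
    integral_comp_fst hπ (hA.integrable_semiDual v)]
  simp [meanDual]
  ring

lemma lintegral_prod_discreteMeasure (hw : ∀ j, 0 < w j) (hw1 : ∑ j, w j = 1)
    {g : 𝒳 × 𝒴 → ENNReal} (hg : Measurable g) :
    ∫⁻ z, g z ∂(μ.prod (discreteMeasure y w)) =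
      ∫⁻ x, ∑ j, ENNReal.ofReal (w j) * g (x, y j) ∂μ := by
  have := isProbabilityMeasure_discreteMeasure y hw hw1
  rw [lintegral_prod _ hg.aemeasurable]
  exact lintegral_congr fun x => lintegral_discreteMeasure y w (hg.comp measurable_prodMk_left)

lemma ofReal_weight_mul_exp (hA : Admissible μ ε w a) (hy : Function.Injective y)
    (v : EuclideanSpace ℝ (Fin J)) (x : 𝒳) (j : Fin J) :
    ENNReal.ofReal (w j) *
      ENNReal.ofReal (Real.exp (extend y (fun x => logDensity ε w v (a x)) (x, y j))) =
      ENNReal.ofReal (gibbs ε w (a x) v j) := by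
  have := hA.nonempty
  rw [extend_apply hy, exp_logDensity hA.eps_pos hA.weight_pos,
    ← ENNReal.ofReal_mul (hA.weight_pos j).le, mul_div_cancel₀ _ (hA.weight_pos j).ne']

lemma sum_ofReal_gibbs (hA : Admissible μ ε w a) (v : EuclideanSpace ℝ (Fin J)) (x : 𝒳) :
    ∑ j, ENNReal.ofReal (gibbs ε w (a x) v j) = 1 := by
  have := hA.nonempty
  rw [← ENNReal.ofReal_sum_of_nonneg fun j _ => (gibbs_pos hA.weight_pos j).le,
    sum_gibbs hA.weight_pos, ENNReal.ofReal_one]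

/-- On each fibre over x the Gibbs weights sum to 1. This normalization holds for every v, so weak
duality is available at every v. -/
lemma lintegral_exp_extend_logDensity (hA : Admissible μ ε w a) (hy : Function.Injective y)
    (v : EuclideanSpace ℝ (Fin J)) :
    ∫⁻ z, ENNReal.ofReal (Real.exp (extend y (fun x => logDensity ε w v (a x)) z))
      ∂(μ.prod (discreteMeasure y w)) = 1 := by
  have hm := measurable_extend y (measurable_logDensity (ε := ε) (w := w) hA.measurable v)
  rw [lintegral_prod_discreteMeasure hA.weight_pos hA.weight_sum hm.exp.ennreal_ofReal]
  simp only [ofReal_weight_mul_exp hA hy, sum_ofReal_gibbs hA]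
  simp

/-- The Gibbs coupling attached to the dual vector `v`. -/
def gibbsCoupling (μ : Measure 𝒳) (ε : ℝ) (y : Fin J → 𝒴) (w : Fin J → ℝ)
    (a : 𝒳 → Fin J → ℝ) (v : EuclideanSpace ℝ (Fin J)) : Measure (𝒳 × 𝒴) :=
  (μ.prod (discreteMeasure y w)).withDensity fun z =>
    ENNReal.ofReal (Real.exp (extend y (fun x => logDensity ε w v (a x)) z))

lemma lintegral_gibbsCoupling (hA : Admissible μ ε w a) (hy : Function.Injective y)
    (v : EuclideanSpace ℝ (Fin J)) {g : 𝒳 × 𝒴 → ENNReal} (hg : Measurable g) :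
    ∫⁻ z, g z ∂(gibbsCoupling μ ε y w a v) =
      ∫⁻ x, ∑ j, ENNReal.ofReal (gibbs ε w (a x) v j) * g (x, y j) ∂μ := by
  have hm := (measurable_extend y
    (measurable_logDensity (ε := ε) (w := w) hA.measurable v)).exp.ennreal_ofReal
  rw [gibbsCoupling, lintegral_withDensity_eq_lintegral_mul _ hm hg,
    lintegral_prod_discreteMeasure hA.weight_pos hA.weight_sum (hm.mul hg)]
  simp only [Pi.mul_apply, ← mul_assoc, ofReal_weight_mul_exp hA hy]

/-- The first-order condition read coordinatewise: the mean Gibbs weight of j is w_j, which is the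
second marginal constraint. -/
lemma lintegral_gibbs (hA : Admissible μ ε w a) {v : EuclideanSpace ℝ (Fin J)}
    (hv : meanDualGrad μ ε w a v = 0) (j : Fin J) :
    ∫⁻ x, ENNReal.ofReal (gibbs ε w (a x) v j) ∂μ = ENNReal.ofReal (w j) := by
  have := hA.nonempty
  have h1 : Integrable (fun x => gibbs ε w (a x) v j) μ := by
    refine ((integrable_semiDualGrad_apply (ε := ε) (μ := μ) hA.weight_pos hA.weight_sum
      hA.measurable v j).add (integrable_const (w j))).congr (Eventually.of_forall fun x => ?_)
    simp [semiDualGrad]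
  rw [← ofReal_integral_eq_lintegral_ofReal h1
    (Eventually.of_forall fun x => (gibbs_pos hA.weight_pos j).le)]
  have h2 : meanDualGrad μ ε w a v j = 0 := by rw [hv]; rfl
  simp only [meanDualGrad, semiDualGrad] at h2
  rw [integral_sub h1 (integrable_const _)] at h2
  simp at h2
  congr 1
  linarith

lemma gibbsCoupling_mem_couplings (hA : Admissible μ ε w a) (hy : Function.Injective y)
    {v : EuclideanSpace ℝ (Fin J)} (hv : meanDualGrad μ ε w a v = 0) :
    gibbsCoupling μ ε y w a v ∈ couplings μ (discreteMeasure y w) := by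
  have hgm : ∀ j, Measurable fun x => ENNReal.ofReal (gibbs ε w (a x) v j) := fun j =>
    (Measurable.comp (g := fun p : 𝒳 × EuclideanSpace ℝ (Fin J) => gibbs ε w (a p.1) p.2 j)
      (f := fun x => (x, v)) (measurable_gibbs hA.measurable j) (by fun_prop)).ennreal_ofReal
  constructor
  · ext s hs
    rw [Measure.fst_apply hs, ← lintegral_indicator_one (measurable_fst hs),
      lintegral_gibbsCoupling hA hy v (measurable_one.indicator (measurable_fst hs)),
      ← lintegral_indicator_one hs]
    refine lintegral_congr fun x => ?_
    rw [← one_mul (s.indicator 1 x), ← sum_ofReal_gibbs hA v x, Finset.sum_mul]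
    rfl
  · ext s hs
    have hm : ∀ j, Measurable fun x : 𝒳 => ENNReal.ofReal (gibbs ε w (a x) v j) *
        (Prod.snd ⁻¹' s).indicator (1 : 𝒳 × 𝒴 → ENNReal) (x, y j) := fun j => (hgm j).mul
      ((measurable_one.indicator (measurable_snd hs)).comp measurable_prodMk_right)
    rw [Measure.snd_apply hs, ← lintegral_indicator_one (measurable_snd hs),
      lintegral_gibbsCoupling hA hy v (measurable_one.indicator (measurable_snd hs)),
      ← lintegral_indicator_one hs, lintegral_discreteMeasure y w (measurable_one.indicator hs),
      lintegral_finsetSum _ fun j _ => hm j]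
    refine Finset.sum_congr rfl fun j _ => ?_
    rw [← lintegral_gibbs hA hv j, ← lintegral_mul_const _ (hgm j)]
    rfl

lemma lintegral_cost (hy : Function.Injective y) {c : 𝒳 × 𝒴 → ℝ} (hc0 : ∀ z, 0 ≤ c z)
    (hA : Admissible μ ε w fun x j => c (x, y j)) {π : Measure (𝒳 × 𝒴)}
    (hπ : π ∈ couplings μ (discreteMeasure y w)) :
    ((∫⁻ z, ENNReal.ofReal (c z) ∂π : ENNReal) : EReal) =
      ((∫ z, extend y (fun x j => c (x, y j)) z ∂π : ℝ) : EReal) := by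
  have hae := ae_eq_extend hy hπ c
  have h0 : 0 ≤ᵐ[π] extend y fun x j => c (x, y j) := by
    filter_upwards [hae] with z hz
    rw [← hz]; exact hc0 z
  have h1 : ∫⁻ z, ENNReal.ofReal (c z) ∂π =
      ENNReal.ofReal (∫ z, extend y (fun x j => c (x, y j)) z ∂π) := by
    rw [ofReal_integral_eq_lintegral_ofReal (integrable_extend hπ hA.measurable hA.integrable) h0]
    refine lintegral_congr_ae ?_
    filter_upwards [hae] with z hz
    rw [hz]
  rw [h1, EReal.coe_ennreal_ofReal, max_eq_left (integral_nonneg_of_ae h0)]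

/-- Weak duality. -/
lemma neg_meanDual_le_transportCost (hy : Function.Injective y) {c : 𝒳 × 𝒴 → ℝ}
    (hc0 : ∀ z, 0 ≤ c z) (hA : Admissible μ ε w fun x j => c (x, y j))
    (v : EuclideanSpace ℝ (Fin J)) {π : Measure (𝒳 × 𝒴)}
    (hπ : π ∈ couplings μ (discreteMeasure y w)) :
    ((-meanDual μ ε w (fun x j => c (x, y j)) v : ℝ) : EReal) ≤
      transportCost c ε μ (discreteMeasure y w) π := by
  have hε := hA.eps_pos
  have : IsProbabilityMeasure π := isProbabilityMeasure_of_mem_couplings hπ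
  have := isProbabilityMeasure_discreteMeasure y hA.weight_pos hA.weight_sum
  rw [transportCost, lintegral_cost hy hc0 hA hπ, KL]
  split_ifs with h
  · have h1 := integral_le_integral_log_rnDeriv h.1
      (measurable_extend y (measurable_logDensity (ε := ε) (w := w) hA.measurable v))
      (integrable_extend hπ (measurable_logDensity hA.measurable v)
        (integrable_logDensity hA v)) h.2 (lintegral_exp_extend_logDensity hA hy v).le
    have h2 := integral_extend_logDensity hA hy v hπ
    have h3 := mul_le_mul_of_nonneg_left h1 hε.le
    rw [integral_sub h.2 (integrable_const _), ← EReal.coe_mul, ← EReal.coe_add,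
      EReal.coe_le_coe_iff]
    simp only [integral_const, probReal_univ, smul_eq_mul, mul_one, mul_sub]
    linarith
  · rw [EReal.coe_mul_top_of_pos hε, EReal.coe_add_top]
    exact le_top

/-- Strong duality, with the Gibbs coupling as a minimizer. -/
lemma transportCost_gibbsCoupling (hy : Function.Injective y) {c : 𝒳 × 𝒴 → ℝ}
    (hc0 : ∀ z, 0 ≤ c z) (hA : Admissible μ ε w fun x j => c (x, y j))
    {v : EuclideanSpace ℝ (Fin J)}
    (hv : meanDualGrad μ ε w (fun x j => c (x, y j)) v = 0) :
    transportCost c ε μ (discreteMeasure y w)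
      (gibbsCoupling μ ε y w (fun x j => c (x, y j)) v) =
      ((-meanDual μ ε w (fun x j => c (x, y j)) v : ℝ) : EReal) := by
  have hπ := gibbsCoupling_mem_couplings hA hy hv
  have hlog : (fun z => Real.log (((gibbsCoupling μ ε y w (fun x j => c (x, y j)) v).rnDeriv
      (μ.prod (discreteMeasure y w))) z).toReal)
      =ᵐ[gibbsCoupling μ ε y w (fun x j => c (x, y j)) v]
      extend y fun x => logDensity ε w v fun j => c (x, y j) := by
    have := isProbabilityMeasure_discreteMeasure y hA.weight_pos hA.weight_sum
    have hac : gibbsCoupling μ ε y w (fun x j => c (x, y j)) v ≪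
        μ.prod (discreteMeasure y w) := withDensity_absolutelyContinuous _ _
    have hm := (measurable_extend y
      (measurable_logDensity (ε := ε) (w := w) hA.measurable v)).exp.ennreal_ofReal
    filter_upwards [hac.ae_le (Measure.rnDeriv_withDensity (μ.prod (discreteMeasure y w)) hm)]
      with z hz
    rw [gibbsCoupling, hz, ENNReal.toReal_ofReal (Real.exp_pos _).le, Real.log_exp]
  have hi := integrable_extend hπ (measurable_logDensity (ε := ε) hA.measurable v)
    (integrable_logDensity hA v)
  have : IsProbabilityMeasure (gibbsCoupling μ ε y w (fun x j => c (x, y j)) v) :=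
    isProbabilityMeasure_of_mem_couplings hπ
  have hi2 := hi.congr hlog.symm
  rw [transportCost, lintegral_cost hy hc0 hA hπ, KL,
    if_pos ⟨withDensity_absolutelyContinuous _ _, hi2⟩, integral_sub hi2 (integrable_const _),
    integral_congr_ae hlog, ← EReal.coe_mul, ← EReal.coe_add, EReal.coe_eq_coe_iff]
  have h2 := integral_extend_logDensity hA hy v hπ
  simp only [integral_const, probReal_univ, smul_eq_mul, mul_one, mul_sub]
  linarith

end Duality

/-! ### Spectral bounds for the preconditioning matrices -/

section Matrices

variable {J : ℕ}

lemma inner_toEuclideanLin_symm {S : Matrix (Fin J) (Fin J) ℝ} (hS : S.IsHermitian)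
    (x z : EuclideanSpace ℝ (Fin J)) :
    inner ℝ (Matrix.toEuclideanLin S x) z = inner ℝ x (Matrix.toEuclideanLin S z) :=
  Matrix.isSymmetric_toEuclideanLin_iff.2 hS x z

/-- Coercivity excludes a kernel, so the determinant is a unit and `S⁻¹` is the true inverse rather
than the default value 0. -/
lemma toEuclideanLin_inv_apply {S : Matrix (Fin J) (Fin J) ℝ} {l : ℝ} (hl : 0 < l)
    (hS : ∀ x, l * ‖x‖ ^ 2 ≤ inner ℝ x (Matrix.toEuclideanLin S x))
    (g : EuclideanSpace ℝ (Fin J)) :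
    Matrix.toEuclideanLin S (Matrix.toEuclideanLin S⁻¹ g) = g := by
  have hdet : IsUnit S.det := by
    rw [isUnit_iff_ne_zero]
    intro h0
    obtain ⟨z, hz, hSz⟩ := Matrix.exists_mulVec_eq_zero_iff.2 h0
    have h1 := hS (WithLp.toLp 2 z)
    rw [Matrix.toLpLin_apply, hSz] at h1
    simp only [WithLp.toLp_zero, inner_zero_right] at h1
    have h2 : ‖(WithLp.toLp 2 z : EuclideanSpace ℝ (Fin J))‖ ≠ 0 := by
      rw [norm_ne_zero_iff]
      intro h
      exact hz (by simpa using congrArg WithLp.ofLp h)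
    have : 0 < l * ‖(WithLp.toLp 2 z : EuclideanSpace ℝ (Fin J))‖ ^ 2 := by positivity
    linarith
  rw [Matrix.toLpLin_apply, Matrix.toLpLin_apply]
  simp [Matrix.mulVec_mulVec, Matrix.mul_nonsing_inv _ hdet]

lemma norm_toEuclideanLin_inv_le {S : Matrix (Fin J) (Fin J) ℝ} {l : ℝ} (hl : 0 < l)
    (hS : ∀ x, l * ‖x‖ ^ 2 ≤ inner ℝ x (Matrix.toEuclideanLin S x))
    (g : EuclideanSpace ℝ (Fin J)) :
    ‖Matrix.toEuclideanLin S⁻¹ g‖ ≤ ‖g‖ / l := by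
  set u := Matrix.toEuclideanLin S⁻¹ g with hu
  have h1 := hS u
  rw [hu, toEuclideanLin_inv_apply hl hS, ← hu] at h1
  have h2 := real_inner_le_norm u g
  rw [le_div_iff₀ hl]
  rcases (norm_nonneg u).eq_or_lt with h | h
  · rw [← h, zero_mul]; exact norm_nonneg g
  · have h3 : ‖u‖ * (‖u‖ * l) ≤ ‖u‖ * ‖g‖ := by linarith [h1.trans h2, sq ‖u‖]
    exact le_of_mul_le_mul_left h3 h

/-- Expand 0 ≤ ⟨u - g/L, S(u - g/L)⟩ with u = S⁻¹g and bound ⟨g, Sg⟩ by L‖g‖²; no diagonalization is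
required. -/
lemma le_inner_toEuclideanLin_inv {S : Matrix (Fin J) (Fin J) ℝ} (hSh : S.IsHermitian)
    {l L : ℝ} (hl : 0 < l) (hL : 0 < L)
    (hS : ∀ x, l * ‖x‖ ^ 2 ≤ inner ℝ x (Matrix.toEuclideanLin S x))
    (hS' : ∀ x, inner ℝ x (Matrix.toEuclideanLin S x) ≤ L * ‖x‖ ^ 2)
    (g : EuclideanSpace ℝ (Fin J)) :
    ‖g‖ ^ 2 / L ≤ inner ℝ g (Matrix.toEuclideanLin S⁻¹ g) := by
  set u := Matrix.toEuclideanLin S⁻¹ g with hu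
  have hSu : Matrix.toEuclideanLin S u = g := toEuclideanLin_inv_apply hl hS g
  have h1 := hS (u - L⁻¹ • g)
  have h2 := hS' g
  have h0 : 0 ≤ l * ‖u - L⁻¹ • g‖ ^ 2 := by positivity
  have h3 : inner ℝ (u - L⁻¹ • g) (Matrix.toEuclideanLin S (u - L⁻¹ • g)) =
      inner ℝ g u - 2 * L⁻¹ * ‖g‖ ^ 2 + L⁻¹ ^ 2 * inner ℝ g (Matrix.toEuclideanLin S g) := by
    rw [map_sub, map_smul, hSu, inner_sub_left, inner_sub_right, inner_sub_right,
      real_inner_smul_left, real_inner_smul_left, real_inner_smul_right, real_inner_smul_right,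
      ← inner_toEuclideanLin_symm hSh u g, hSu, real_inner_comm, real_inner_self_eq_norm_sq]
    ring
  have h4 : L⁻¹ ^ 2 * inner ℝ g (Matrix.toEuclideanLin S g) ≤ L⁻¹ * ‖g‖ ^ 2 := by
    calc _ ≤ L⁻¹ ^ 2 * (L * ‖g‖ ^ 2) := mul_le_mul_of_nonneg_left h2 (by positivity)
      _ = _ := by field_simp
  rw [div_eq_inv_mul]
  linarith

lemma inner_toEuclideanLin_vecMulVec (g : Fin J → ℝ) (x : EuclideanSpace ℝ (Fin J)) :
    inner ℝ x (Matrix.toEuclideanLin (Matrix.vecMulVec g g) x) = (∑ j, g j * x j) ^ 2 := by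
  rw [inner_eq_sum, sq, Finset.sum_mul]
  refine Finset.sum_congr rfl fun i _ => ?_
  rw [Matrix.toLpLin_apply]
  simp only [Matrix.mulVec, dotProduct, Matrix.vecMulVec_apply, mul_assoc, ← Finset.mul_sum]
  ring

lemma sum_Z_mul_sq {w : Fin J → ℝ} (hw : ∀ j, 0 < w j) (x : EuclideanSpace ℝ (Fin J)) (k : ℕ) :
    (∑ j, Z w (k + 1) j * x j) ^ 2 = ∑ j : Fin J, if k % J = j then w j * x j ^ 2 else 0 := by
  rcases Nat.eq_zero_or_pos J with rfl | hJ
  · simp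
  simp only [Z, Nat.add_sub_cancel, ite_mul, zero_mul]
  have key : ∀ f : Fin J → ℝ, (∑ j : Fin J, if (j : ℕ) = k % J then f j else 0) =
      f ⟨k % J, Nat.mod_lt _ hJ⟩ := fun f => by
    rw [Finset.sum_eq_single ⟨k % J, Nat.mod_lt _ hJ⟩]
    · simp
    · intro b _ hb
      rw [if_neg fun h => hb (Fin.ext h)]
    · simp
  simp only [eq_comm (a := k % J)]
  rw [key, key, mul_pow, Real.sq_sqrt (hw _).le]

/-- The cyclic choice of Z_k visits every coordinate once per block of length J. -/
lemma div_le_card_filter_mod_eq (n : ℕ) (j : Fin J) :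
    n / J ≤ ((Finset.range n).filter fun k => k % J = j).card := by
  have h := Nat.count_modEq_card n j.pos (j : ℕ)
  rw [Nat.count_eq_card_filter_range] at h
  have h2 : ((Finset.range n).filter fun k => k ≡ j [MOD J]) =
      (Finset.range n).filter fun k => k % J = j := by
    refine Finset.filter_congr fun k _ => ?_
    rw [Nat.ModEq, Nat.mod_eq_of_lt j.2]
  rw [h2] at h
  omega

/-- The recursion satisfied by the preconditioning matrices along the gradients `φ`. -/
structure IsPreconditioner (γ β : ℝ) (w : Fin J → ℝ) (φ : ℕ → EuclideanSpace ℝ (Fin J))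
    (S : ℕ → Matrix (Fin J) (Fin J) ℝ) : Prop where
  zero : S 0 = 1
  succ : ∀ n, S (n + 1) = S n + Matrix.vecMulVec (φ n) (φ n)
    + (γ * (1 + (((n + 1) / J : ℕ) : ℝ)) ^ (-β)) •
      Matrix.vecMulVec (Z w (n + 1)) (Z w (n + 1))

namespace IsPreconditioner

variable {γ β : ℝ} {w : Fin J → ℝ} {φ : ℕ → EuclideanSpace ℝ (Fin J)}
  {S : ℕ → Matrix (Fin J) (Fin J) ℝ}

lemma isHermitian (hS : IsPreconditioner γ β w φ S) (n : ℕ) : (S n).IsHermitian := by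
  have hv : ∀ g : Fin J → ℝ, (Matrix.vecMulVec g g).IsHermitian := fun g => by
    ext i j; simp [Matrix.vecMulVec_apply, mul_comm]
  induction n with
  | zero => rw [hS.zero]; exact Matrix.isHermitian_one
  | succ n ih =>
    rw [hS.succ]
    refine (ih.add (hv _)).add ?_
    have h := hv (Z w (n + 1))
    rw [Matrix.IsHermitian] at h ⊢
    rw [Matrix.conjTranspose_smul, h]
    simp

lemma inner_succ (hS : IsPreconditioner γ β w φ S) (x : EuclideanSpace ℝ (Fin J)) (n : ℕ) :
    inner ℝ x (Matrix.toEuclideanLin (S (n + 1)) x) =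
      inner ℝ x (Matrix.toEuclideanLin (S n) x) + inner ℝ (φ n) x ^ 2
      + γ * (1 + (((n + 1) / J : ℕ) : ℝ)) ^ (-β) * (∑ j, Z w (n + 1) j * x j) ^ 2 := by
  rw [hS.succ, map_add, map_add, map_smul, LinearMap.add_apply, LinearMap.add_apply,
    LinearMap.smul_apply, inner_add_right, inner_add_right, real_inner_smul_right,
    inner_toEuclideanLin_vecMulVec, inner_toEuclideanLin_vecMulVec, inner_eq_sum (φ n)]

lemma inner_zero (hS : IsPreconditioner γ β w φ S) (x : EuclideanSpace ℝ (Fin J)) :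
    inner ℝ x (Matrix.toEuclideanLin (S 0) x) = ‖x‖ ^ 2 := by
  rw [hS.zero, Matrix.toLpLin_apply, Matrix.one_mulVec, ← real_inner_self_eq_norm_sq]

/-- Each update adds at most (J + γ)‖x‖² to the quadratic form. -/
lemma inner_le (hS : IsPreconditioner γ β w φ S) (hw : ∀ j, 0 < w j) (hw1 : ∑ j, w j = 1)
    (hγ : 0 < γ) (hβ : 0 < β) (hφ : ∀ n, ‖φ n‖ ≤ √J) (n : ℕ) (x : EuclideanSpace ℝ (Fin J)) :
    inner ℝ x (Matrix.toEuclideanLin (S n) x) ≤ ((1 + J + γ) * (n + 1)) * ‖x‖ ^ 2 := by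
  induction n with
  | zero =>
    rw [hS.inner_zero]
    have : 0 ≤ (J + γ) * ‖x‖ ^ 2 := by positivity
    push_cast
    linarith
  | succ n ih =>
    rw [hS.inner_succ]
    have h1 : inner ℝ (φ n) x ^ 2 ≤ J * ‖x‖ ^ 2 := by
      have h := (abs_real_inner_le_norm (φ n) x).trans
        (mul_le_mul_of_nonneg_right (hφ n) (norm_nonneg x))
      rw [← sq_abs]
      calc |inner ℝ (φ n) x| ^ 2 ≤ (√J * ‖x‖) ^ 2 := pow_le_pow_left₀ (abs_nonneg _) h 2
        _ = _ := by rw [mul_pow, Real.sq_sqrt (Nat.cast_nonneg J)]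
    have h2 : (1 + (((n + 1) / J : ℕ) : ℝ)) ^ (-β) ≤ 1 :=
      Real.rpow_le_one_of_one_le_of_nonpos (by linarith [Nat.cast_nonneg (α := ℝ) ((n + 1) / J)])
        (by linarith)
    have h3 : (∑ j, Z w (n + 1) j * x j) ^ 2 ≤ ‖x‖ ^ 2 := by
      rw [sum_Z_mul_sq hw, EuclideanSpace.norm_sq_eq]
      refine Finset.sum_le_sum fun j _ => ?_
      rw [Real.norm_eq_abs, sq_abs]
      split_ifs
      · exact mul_le_of_le_one_left (sq_nonneg _) (le_one_of_sum_eq_one hw hw1 j)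
      · exact sq_nonneg _
    have h4 : γ * (1 + (((n + 1) / J : ℕ) : ℝ)) ^ (-β) * (∑ j, Z w (n + 1) j * x j) ^ 2 ≤
        γ * 1 * ‖x‖ ^ 2 := by gcongr
    have h5 := sq_nonneg ‖x‖
    push_cast
    linarith

/-- All damping factors up to time n are at least (n+1)^(-β). Fixing n and inducting on m keeps this
common factor constant; the gradient terms are nonnegative and dropped. -/
lemma le_inner_sum (hS : IsPreconditioner γ β w φ S) (hγ : 0 < γ) (hβ : 0 < β) {n m : ℕ}
    (hm : m ≤ n) (x : EuclideanSpace ℝ (Fin J)) :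
    ‖x‖ ^ 2 + γ * (n + 1 : ℝ) ^ (-β) *
        ∑ k ∈ Finset.range m, (∑ j, Z w (k + 1) j * x j) ^ 2 ≤
      inner ℝ x (Matrix.toEuclideanLin (S m) x) := by
  induction m with
  | zero => simp [hS.inner_zero]
  | succ m ih =>
    rw [hS.inner_succ, Finset.sum_range_succ]
    have h1 := ih (by omega)
    have h2 : (n + 1 : ℝ) ^ (-β) ≤ (1 + (((m + 1) / J : ℕ) : ℝ)) ^ (-β) := by
      refine Real.rpow_le_rpow_of_nonpos (by positivity) ?_ (by linarith)
      have : (m + 1) / J ≤ n := (Nat.div_le_self _ _).trans hm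
      have : (((m + 1) / J : ℕ) : ℝ) ≤ n := by exact_mod_cast this
      linarith
    have h3 : γ * (n + 1 : ℝ) ^ (-β) * (∑ j, Z w (m + 1) j * x j) ^ 2 ≤
        γ * (1 + (((m + 1) / J : ℕ) : ℝ)) ^ (-β) * (∑ j, Z w (m + 1) j * x j) ^ 2 := by gcongr
    have h4 := sq_nonneg (inner ℝ (φ m) x)
    rw [mul_add]
    linarith

/-- About n/J visits to each coordinate, each of weight at least γ w_j (n+1)^(-β), give growth of
order n^(1-β). The constant κ is uniform over runs, so the later noise bounds are deterministic. -/
lemma exists_le_inner (hw : ∀ j, 0 < w j) (hw1 : ∑ j, w j = 1)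
    (hγ : 0 < γ) (hβ : 0 < β) : ∃ κ > 0, ∀ φ S, IsPreconditioner γ β w φ S → ∀ (n : ℕ)
      (x : EuclideanSpace ℝ (Fin J)), κ * (n + 1 : ℝ) ^ (1 - β) * ‖x‖ ^ 2 ≤
      inner ℝ x (Matrix.toEuclideanLin (S n) x) := by
  have := nonempty_of_sum_eq_one hw1
  obtain ⟨j₀, hj₀⟩ := Finite.exists_min w
  have hJ : (0 : ℝ) < J := by exact_mod_cast j₀.pos
  have hw0 := hw j₀
  -- The entry 1 accounts for S_0 = I, which supplies coercivity before the first block is complete.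
  set κ := min 1 (γ * w j₀) with hκ
  have hκ0 : 0 < κ := by positivity
  refine ⟨κ / J, by positivity, fun φ S hS n x => ?_⟩
  refine le_trans ?_ (hS.le_inner_sum hγ hβ le_rfl x)
  have hn : (0 : ℝ) < n + 1 := by positivity
  have h1 : w j₀ * (n / J : ℕ) * ‖x‖ ^ 2 ≤
      ∑ k ∈ Finset.range n, (∑ j, Z w (k + 1) j * x j) ^ 2 := by
    simp only [sum_Z_mul_sq hw]
    rw [Finset.sum_comm, EuclideanSpace.norm_sq_eq, Finset.mul_sum]
    refine Finset.sum_le_sum fun j _ => ?_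
    rw [← Finset.sum_filter, Finset.sum_const, nsmul_eq_mul, Real.norm_eq_abs, sq_abs]
    have h2 : ((n / J : ℕ) : ℝ) ≤ ((Finset.range n).filter fun k => k % J = j).card := by
      exact_mod_cast div_le_card_filter_mod_eq n j
    calc w j₀ * (n / J : ℕ) * x j ^ 2 = (n / J : ℕ) * (w j₀ * x j ^ 2) := by ring
      _ ≤ _ := mul_le_mul h2 (mul_le_mul_of_nonneg_right (hj₀ j) (sq_nonneg _))
        (by positivity) (by positivity)
  have h2 : (n + 1 : ℝ) / J ≤ 1 + (n / J : ℕ) := by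
    rw [div_le_iff₀ hJ]
    have h3 : n + 1 ≤ (1 + n / J) * J := by
      have := Nat.div_add_mod n J
      have := Nat.mod_lt n j₀.pos
      nlinarith
    exact_mod_cast h3
  have h3 : (n + 1 : ℝ) ^ (1 - β) = (n + 1 : ℝ) ^ (-β) * (n + 1) := by
    rw [sub_eq_neg_add, Real.rpow_add hn, Real.rpow_one]
  have h4 : (n + 1 : ℝ) ^ (-β) ≤ 1 :=
    Real.rpow_le_one_of_one_le_of_nonpos (by linarith [Nat.cast_nonneg (α := ℝ) n]) (by linarith)
  have h5 : 0 < (n + 1 : ℝ) ^ (-β) := Real.rpow_pos_of_pos hn _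
  set p := (n + 1 : ℝ) ^ (-β)
  set N : ℝ := ((n / J : ℕ) : ℝ) with hN
  have hN0 : 0 ≤ N := Nat.cast_nonneg _
  calc κ / J * (n + 1 : ℝ) ^ (1 - β) * ‖x‖ ^ 2
      = κ * p * ((n + 1) / J) * ‖x‖ ^ 2 := by rw [h3]; ring
    _ ≤ κ * p * (1 + N) * ‖x‖ ^ 2 := by gcongr
    _ = κ * p * ‖x‖ ^ 2 + κ * (p * N * ‖x‖ ^ 2) := by ring
    _ ≤ 1 * 1 * ‖x‖ ^ 2 + γ * w j₀ * (p * N * ‖x‖ ^ 2) := by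
        gcongr
        · exact min_le_left _ _
        · exact min_le_right _ _
    _ = ‖x‖ ^ 2 + γ * p * (w j₀ * N * ‖x‖ ^ 2) := by ring
    _ ≤ _ := by gcongr

end IsPreconditioner

end Matrices

/-! ### Martingale convergence and independence of the past -/

section Martingale

/-- A function of a conditionally frozen variable and of an independent variable has zero
conditional expectation if its partial integrals vanish. -/
lemma condExp_eq_zero_of_indep {Ω T S : Type*} [MeasurableSpace T] [MeasurableSpace S]
    {m mΩ : MeasurableSpace Ω} {P : Measure Ω} [IsProbabilityMeasure P] (hm : m ≤ mΩ) {Y : Ω → T} (hY : Measurable[m] Y) {X : Ω → S}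
    (hX : Measurable X) (hind : Indep m (MeasurableSpace.comap X inferInstance) P)
    {f : T × S → ℝ} (hf : Measurable f) (hfi : Integrable (fun ω => f (Y ω, X ω)) P)
    (h0 : ∀ t, ∫ s, f (t, s) ∂(P.map X) = 0) : P[fun ω => f (Y ω, X ω) | m] =ᵐ[P] 0 := by
  refine (ae_eq_condExp_of_forall_setIntegral_eq hm hfi (fun s _ _ => integrableOn_zero)
    (fun A hA _ => ?_) aestronglyMeasurable_zero).symm
  simp only [integral_zero]
  -- The conditioning event is carried as an extra coordinate, so that the integral over A becomes
  -- an integral over a product law and Fubini applies.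
  set Y' : Ω → T × ℝ := fun ω => (Y ω, A.indicator 1 ω) with hY'
  have hAm : Measurable[m] (A.indicator (1 : Ω → ℝ)) :=
    Measurable.indicator (@measurable_const ℝ Ω _ m 1) hA
  have hY'm : Measurable[m] Y' := hY.prodMk hAm
  have hY'Ω : Measurable Y' := hY'm.mono hm le_rfl
  have hi : IndepFun Y' X P := indep_of_indep_of_le_left hind hY'm.comap_le
  have hmap := (indepFun_iff_map_prod_eq_prod_map_map hY'Ω.aemeasurable hX.aemeasurable).1 hi
  set g : (T × ℝ) × S → ℝ := fun q => q.1.2 * f (q.1.1, q.2) with hg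
  have hgm : Measurable g := by
    have : Measurable fun q : (T × ℝ) × S => f (q.1.1, q.2) := hf.comp (by fun_prop)
    exact (measurable_snd.comp measurable_fst).mul this
  have hcomp : A.indicator (fun ω => f (Y ω, X ω)) = fun ω => g (Y' ω, X ω) := by
    ext ω
    by_cases h : ω ∈ A <;> simp [hg, hY', h]
  have hgi : Integrable g ((P.map Y').prod (P.map X)) := by
    rw [← hmap, integrable_map_measure hgm.aestronglyMeasurable (hY'Ω.prodMk hX).aemeasurable]
    change Integrable (fun ω => g (Y' ω, X ω)) P
    rw [← hcomp]
    exact hfi.indicator (hm A hA)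
  rw [← integral_indicator (hm A hA), hcomp,
    ← integral_map (φ := fun ω => (Y' ω, X ω)) (hY'Ω.prodMk hX).aemeasurable
      hgm.aestronglyMeasurable, hmap]
  have := Measure.isProbabilityMeasure_map (μ := P) hX.aemeasurable
  have := Measure.isProbabilityMeasure_map (μ := P) hY'Ω.aemeasurable
  rw [integral_prod _ hgi]
  simp [hg, integral_const_mul, h0]

variable {Ω : Type*} {mΩ : MeasurableSpace Ω} {P : Measure Ω} [IsProbabilityMeasure P]

/-- Almost sure convergence of a martingale with bounded, square-summable increments. -/
lemma ae_exists_tendsto_sum_of_condExp_eq_zero {ℱ : Filtration ℕ mΩ} {ξ : ℕ → Ω → ℝ} {b : ℕ → ℝ}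
    (hξ : ∀ n, StronglyMeasurable[ℱ (n + 1)] (ξ n)) (hb : ∀ n ω, |ξ n ω| ≤ b n)
    (hsum : Summable fun n => b n ^ 2) (h0 : ∀ n, P[ξ n | ℱ n] =ᵐ[P] 0) :
    ∀ᵐ ω ∂P, ∃ l, Tendsto (fun n => ∑ k ∈ Finset.range n, ξ k ω) atTop (𝓝 l) := by
  set M : ℕ → Ω → ℝ := fun n ω => ∑ k ∈ Finset.range n, ξ k ω with hM
  have hξΩ : ∀ n, StronglyMeasurable (ξ n) := fun n => (hξ n).mono (ℱ.le _)
  have hξi : ∀ n, Integrable (ξ n) P := fun n =>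
    Integrable.of_bound (hξΩ n).aestronglyMeasurable (b n) (Eventually.of_forall (hb n))
  have hMm : ∀ n, StronglyMeasurable[ℱ n] (M n) := fun n =>
    Finset.stronglyMeasurable_fun_sum _ fun k hk =>
      (hξ k).mono (ℱ.mono (by have := Finset.mem_range.1 hk; omega))
  have hMΩ : ∀ n, StronglyMeasurable (M n) := fun n => (hMm n).mono (ℱ.le _)
  have hMi : ∀ n, Integrable (M n) P := fun n => integrable_finsetSum _ fun k _ => hξi k
  have hMb : ∀ n ω, ‖M n ω‖ ≤ ∑ k ∈ Finset.range n, b k := fun n ω =>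
    (norm_sum_le _ _).trans (Finset.sum_le_sum fun k _ => hb k ω)
  have hMsucc : ∀ n ω, M (n + 1) ω = M n ω + ξ n ω := fun n ω => Finset.sum_range_succ _ _
  have hmart : Martingale M ℱ P := by
    refine martingale_of_condExp_sub_eq_zero_nat hMm hMi fun n => ?_
    have : M (n + 1) - M n = ξ n := by ext ω; simp [hMsucc]
    rw [this]
    exact h0 n
  -- Orthogonality of increments bounds the second moments by ∑ b_k², hence the L¹ norms through |t|
  -- ≤ 1 + t².
  have horth : ∀ n, ∫ ω, M n ω * ξ n ω ∂P = 0 := fun n => by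
    have hi : Integrable (M n * ξ n) P :=
      (hξi n).bdd_mul (hMΩ n).aestronglyMeasurable (Eventually.of_forall (hMb n))
    have h1 := condExp_mul_of_stronglyMeasurable_left (hMm n) hi (hξi n)
    have h2 : P[M n * ξ n | ℱ n] =ᵐ[P] 0 := by
      filter_upwards [h1, h0 n] with ω h3 h4
      rw [h3, Pi.mul_apply, h4, Pi.zero_apply, mul_zero]
    have h3 := integral_congr_ae h2
    rw [integral_condExp (ℱ.le n)] at h3
    simpa using h3
  have hM2i : ∀ n, Integrable (fun ω => M n ω ^ 2) P := fun n =>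
    Integrable.of_bound ((hMΩ n).pow 2).aestronglyMeasurable ((∑ k ∈ Finset.range n, b k) ^ 2)
      (Eventually.of_forall fun ω => by
        rw [norm_pow]; exact pow_le_pow_left₀ (norm_nonneg _) (hMb n ω) 2)
  have hM2 : ∀ n, ∫ ω, M n ω ^ 2 ∂P ≤ ∑ k ∈ Finset.range n, b k ^ 2 := fun n => by
    induction n with
    | zero => simp [hM]
    | succ n ih =>
      have hi : Integrable (fun ω => M n ω * ξ n ω) P :=
        (hξi n).bdd_mul (hMΩ n).aestronglyMeasurable (Eventually.of_forall (hMb n))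
      have h1 : ∫ ω, M (n + 1) ω ^ 2 ∂P ≤
          ∫ ω, (M n ω ^ 2 + 2 * (M n ω * ξ n ω) + b n ^ 2) ∂P := by
        refine integral_mono (hM2i _) (((hM2i n).add (hi.const_mul 2)).add (integrable_const _))
          fun ω => ?_
        have : ξ n ω ^ 2 ≤ b n ^ 2 := by
          rw [← sq_abs]; exact pow_le_pow_left₀ (abs_nonneg _) (hb n ω) 2
        simp only [hMsucc]
        nlinarith
      have hadd : Integrable (fun ω => M n ω ^ 2 + 2 * (M n ω * ξ n ω)) P :=
        (hM2i n).add (hi.const_mul 2)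
      rw [integral_add hadd (integrable_const _), integral_add (hM2i n) (hi.const_mul 2),
        integral_const_mul, horth] at h1
      simp only [integral_const, probReal_univ, smul_eq_mul, one_mul, mul_zero, add_zero] at h1
      rw [Finset.sum_range_succ]
      linarith
  have hbdd : ∀ n, eLpNorm (M n) 1 P ≤ (Real.toNNReal (1 + ∑' k, b k ^ 2) : ENNReal) := fun n => by
    rw [eLpNorm_one_eq_lintegral_enorm, ← ofReal_integral_norm_eq_lintegral_enorm (hMi n)]
    refine ENNReal.ofReal_le_ofReal ?_
    calc ∫ ω, ‖M n ω‖ ∂P ≤ ∫ ω, (1 + M n ω ^ 2) ∂P := by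
          refine integral_mono (hMi n).norm ((integrable_const _).add (hM2i n)) fun ω => ?_
          rw [Real.norm_eq_abs, ← sq_abs]
          nlinarith [sq_nonneg (|M n ω| - 1)]
      _ = 1 + ∫ ω, M n ω ^ 2 ∂P := by
          rw [integral_add (integrable_const _) (hM2i n)]; simp
      _ ≤ 1 + ∑' k, b k ^ 2 := by
          have := hsum.sum_le_tsum (Finset.range n) fun k _ => sq_nonneg (b k)
          linarith [hM2 n]
  filter_upwards [hmart.submartingale.ae_tendsto_limitProcess hbdd] with ω hω
  exact ⟨_, hω⟩

variable {E S : Type*} [MeasurableSpace E] [MeasurableSpace S]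

/-- The filtration generated by an initial value and a sequence of samples. -/
def history {V : Ω → E} {X : ℕ → Ω → S} (hV : Measurable V) (hX : ∀ n, Measurable (X n)) :
    Filtration ℕ mΩ where
  seq n := MeasurableSpace.comap V inferInstance ⊔
    ⨆ k ∈ Finset.range n, MeasurableSpace.comap (X k) inferInstance
  mono' _ _ hmn := sup_le_sup_left
    (biSup_mono fun _ hk => Finset.range_subset_range.2 hmn hk) _
  le' _ := sup_le hV.comap_le (iSup₂_le fun k _ => (hX k).comap_le)

lemma measurable_history_init {V : Ω → E} {X : ℕ → Ω → S} (hV : Measurable V)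
    (hX : ∀ n, Measurable (X n)) (n : ℕ) : Measurable[history hV hX n] V :=
  Measurable.mono (comap_measurable V) le_sup_left le_rfl

lemma measurable_history_sample {V : Ω → E} {X : ℕ → Ω → S} (hV : Measurable V)
    (hX : ∀ n, Measurable (X n)) (n : ℕ) : Measurable[history hV hX (n + 1)] (X n) :=
  Measurable.mono (comap_measurable (X n))
    (le_sup_of_le_right (le_iSup₂_of_le n (Finset.self_mem_range_succ n) le_rfl)) le_rfl

lemma indepFun_prodMk_left {A B C : Type*} [MeasurableSpace A] [MeasurableSpace B]
    [MeasurableSpace C] {f : Ω → A} {g : Ω → B} {k : Ω → C} (hf : Measurable f)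
    (hg : Measurable g) (hk : Measurable k) (h1 : IndepFun f (fun ω => (g ω, k ω)) P)
    (h2 : IndepFun g k P) : IndepFun (fun ω => (f ω, g ω)) k P := by
  have h3 : IndepFun f g P := h1.comp measurable_id measurable_fst
  rw [indepFun_iff_map_prod_eq_prod_map_map (by fun_prop) (by fun_prop)] at h1 h2 h3 ⊢
  have := Measure.isProbabilityMeasure_map (μ := P) hf.aemeasurable
  have := Measure.isProbabilityMeasure_map (μ := P) hg.aemeasurable
  have := Measure.isProbabilityMeasure_map (μ := P) hk.aemeasurable
  rw [h2, ← Measure.prodAssoc_prod, ← h3] at h1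
  have h4 := congrArg (Measure.map MeasurableEquiv.prodAssoc.symm) h1
  rw [Measure.map_map (by fun_prop) (by fun_prop), Measure.map_map (by fun_prop) (by fun_prop)]
    at h4
  simpa [Function.comp_def] using! h4

lemma indep_history {V : Ω → E} {X : ℕ → Ω → S} (hV : Measurable V)
    (hX : ∀ n, Measurable (X n)) (hXi : iIndepFun X P)
    (hVX : IndepFun V (fun ω n => X n ω) P) (n : ℕ) :
    Indep (history hV hX n) (MeasurableSpace.comap (X n) inferInstance) P := by
  set A : Ω → (Finset.range n → S) := fun ω k => X k ω with hA
  have hAm : Measurable A := measurable_pi_lambda _ fun k => hX k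
  have h1 : IndepFun A (X n) P := by
    have h := hXi.indepFun_finset (Finset.range n) {n} (by simp) hX
    exact h.comp measurable_id (measurable_pi_apply (⟨n, Finset.mem_singleton_self n⟩ :
      ({n} : Finset ℕ)))
  have h2 : IndepFun V (fun ω => (A ω, X n ω)) P :=
    hVX.comp (φ := id) (ψ := fun x : ℕ → S => ((fun k : Finset.range n => x k), x n))
      measurable_id (by fun_prop)
  have h3 := indepFun_prodMk_left hV hAm (hX n) h2 h1
  refine indep_of_indep_of_le_left h3 (sup_le ?_ (iSup₂_le fun k hk => ?_))
  · exact (measurable_fst.comp (comap_measurable fun ω => (V ω, A ω))).comap_le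
  · exact ((measurable_pi_apply (⟨k, hk⟩ : Finset.range n)).comp
      (measurable_snd.comp (comap_measurable fun ω => (V ω, A ω)))).comap_le

end Martingale

/-! ### Deterministic descent lemmas -/

section Descent

/-- A deterministic counterpart of the Robbins-Siegmund theorem. -/
lemma exists_tendsto_and_summable_of_descent {H d ξ e : ℕ → ℝ} {m l : ℝ} (hm : ∀ n, m ≤ H n)
    (hd : ∀ n, 0 ≤ d n) (he : Summable e)
    (hξ : Tendsto (fun n => ∑ k ∈ Finset.range n, ξ k) atTop (𝓝 l))
    (hH : ∀ n, H (n + 1) ≤ H n - d n - ξ n + e n) :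
    (∃ L, Tendsto H atTop (𝓝 L)) ∧ Summable d := by
  -- Adding the convergent compensator R turns H into a nonincreasing sequence bounded below.
  set R : ℕ → ℝ := fun n => ∑ k ∈ Finset.range n, ξ k - ∑ k ∈ Finset.range n, e k with hR
  have hRt : Tendsto R atTop (𝓝 (l - ∑' k, e k)) := hξ.sub he.hasSum.tendsto_sum_nat
  obtain ⟨r, hr⟩ := hRt.bddBelow_range
  have hr' : ∀ n, r ≤ R n := fun n => hr ⟨n, rfl⟩
  have hRs : ∀ n, R (n + 1) = R n + ξ n - e n := fun n => by
    simp only [hR, Finset.sum_range_succ]; ring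
  have hanti : Antitone fun n => H n + R n := antitone_nat_of_succ_le fun n => by
    simp only [hRs]; linarith [hH n, hd n]
  have hbdd : BddBelow (Set.range fun n => H n + R n) := by
    refine ⟨m + r, ?_⟩
    rintro _ ⟨n, rfl⟩
    exact add_le_add (hm n) (hr' n)
  refine ⟨⟨_, ((tendsto_atTop_ciInf hanti hbdd).sub hRt).congr fun n => by ring⟩,
    summable_of_sum_range_le (c := H 0 + R 0 - (m + r)) hd fun n => ?_⟩
  have key : ∑ k ∈ Finset.range n, d k ≤ H 0 + R 0 - (H n + R n) := by
    induction n with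
    | zero => simp
    | succ n ih =>
      rw [Finset.sum_range_succ, hRs]
      linarith [hH n]
  linarith [hm n, hr' n]

/-- Were q eventually at least δ, the summable d would dominate a multiple of the harmonic series.
-/
lemma frequently_lt_of_summable_div {q d : ℕ → ℝ} {L : ℝ} (hL : 0 < L) (hd : Summable d)
    (hqd : ∀ᶠ n : ℕ in atTop, q n / (L * (n + 1)) ≤ d n) {δ : ℝ} (hδ : 0 < δ) :
    ∃ᶠ n in atTop, q n < δ := by
  by_contra h
  rw [not_frequently] at h
  have h1 : Summable fun n : ℕ => 1 / ((n : ℝ) + 1) := by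
    refine Summable.of_norm_bounded_eventually_nat (g := fun n => L / δ * d n)
      (hd.mul_left _) ?_
    filter_upwards [h, hqd] with n hn hn'
    rw [not_lt] at hn
    rw [Real.norm_of_nonneg (by positivity)]
    calc 1 / ((n : ℝ) + 1) = L / δ * (δ / (L * (n + 1))) := by field_simp
      _ ≤ L / δ * (q n / (L * (n + 1))) := by gcongr
      _ ≤ L / δ * d n := by gcongr
  have h2 := (summable_nat_add_iff (f := fun n : ℕ => 1 / (n : ℝ)) 1).1 (by simpa using h1)
  exact Real.not_summable_one_div_natCast h2

end Descent

/-! ### Pathwise convergence of the recursion -/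

section Run

variable {J : ℕ}

/-- The stochastic Gauss-Newton recursion along a sequence `a` of cost vectors. -/
structure IsRun (ε : ℝ) (w : Fin J → ℝ) (α β γ : ℝ) (a : ℕ → Fin J → ℝ)
    (V : ℕ → EuclideanSpace ℝ (Fin J)) (S : ℕ → Matrix (Fin J) (Fin J) ℝ) : Prop where
  precond : IsPreconditioner γ β w (fun n => semiDualGrad ε w (a n) (V n)) S
  succ : ∀ n, V (n + 1) = center (V n - (n : ℝ) ^ α •
    Matrix.toEuclideanLin (S n)⁻¹ (semiDualGrad ε w (a n) (V n)))

/-- The centered fluctuation of the first-order term in the descent inequality. -/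
def noise {𝒳 : Type*} [MeasurableSpace 𝒳] (μ : Measure 𝒳) (ε : ℝ) (w : Fin J → ℝ)
    (a : 𝒳 → Fin J → ℝ) (α : ℝ) (n : ℕ) (V : EuclideanSpace ℝ (Fin J))
    (S : Matrix (Fin J) (Fin J) ℝ) (x : 𝒳) : ℝ :=
  (n : ℝ) ^ α * inner ℝ (meanDualGrad μ ε w a V)
    (Matrix.toEuclideanLin S⁻¹ (semiDualGrad ε w (a x) V - meanDualGrad μ ε w a V))

lemma norm_step_le {κ α β : ℝ} (hκ : 0 < κ) (hα : 0 ≤ α) {n : ℕ} {S : Matrix (Fin J) (Fin J) ℝ}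
    (hS : ∀ x, κ * (n + 1 : ℝ) ^ (1 - β) * ‖x‖ ^ 2 ≤ inner ℝ x (Matrix.toEuclideanLin S x))
    (z : EuclideanSpace ℝ (Fin J)) :
    (n : ℝ) ^ α * ‖Matrix.toEuclideanLin S⁻¹ z‖ ≤ ‖z‖ / κ * (n + 1 : ℝ) ^ (α + β - 1) := by
  have hn : (0 : ℝ) < n + 1 := by positivity
  have h1 := norm_toEuclideanLin_inv_le (mul_pos hκ (Real.rpow_pos_of_pos hn (1 - β))) hS z
  have h2 : (n : ℝ) ^ α ≤ (n + 1 : ℝ) ^ α :=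
    Real.rpow_le_rpow (by positivity) (by linarith) hα
  calc (n : ℝ) ^ α * ‖Matrix.toEuclideanLin S⁻¹ z‖
      ≤ (n + 1 : ℝ) ^ α * (‖z‖ / (κ * (n + 1 : ℝ) ^ (1 - β))) := by gcongr
    _ = ‖z‖ / κ * ((n + 1 : ℝ) ^ α / (n + 1 : ℝ) ^ (1 - β)) := by field_simp
    _ = _ := by rw [← Real.rpow_sub hn]; congr 2; ring

/-- The exponent 2(α+β-1) is below -1 exactly when α + β < 1/2. -/
lemma summable_sq_rpow {α β : ℝ} (hαβ : α + β < 1 / 2) (C : ℝ) :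
    Summable fun n : ℕ => (C * (n + 1 : ℝ) ^ (α + β - 1)) ^ 2 := by
  have h1 : Summable fun n : ℕ => (n : ℝ) ^ ((α + β - 1) * 2) :=
    Real.summable_nat_rpow.2 (by linarith)
  have h2 := ((summable_nat_add_iff 1).2 h1).mul_left (C ^ 2)
  refine h2.congr fun n => ?_
  rw [mul_pow, Nat.cast_add_one, ← Real.rpow_natCast ((n + 1 : ℝ) ^ (α + β - 1)) 2,
    ← Real.rpow_mul (by positivity)]
  norm_num

variable {𝒳 : Type*} [MeasurableSpace 𝒳] {μ : Measure 𝒳} [IsProbabilityMeasure μ] {ε : ℝ}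
  {w : Fin J → ℝ} {a : 𝒳 → Fin J → ℝ} {α β γ : ℝ}

lemma abs_noise_le (hA : Admissible μ ε w a) {κ : ℝ} (hκ : 0 < κ) (hα : 0 ≤ α) {n : ℕ}
    {S : Matrix (Fin J) (Fin J) ℝ}
    (hS : ∀ x, κ * (n + 1 : ℝ) ^ (1 - β) * ‖x‖ ^ 2 ≤ inner ℝ x (Matrix.toEuclideanLin S x))
    (V : EuclideanSpace ℝ (Fin J)) (x : 𝒳) :
    |noise μ ε w a α n V S x| ≤ √J * (2 * √J / κ) * (n + 1 : ℝ) ^ (α + β - 1) := by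
  have := hA.nonempty
  have hG := hA.norm_meanDualGrad_le V
  have hz : ‖semiDualGrad ε w (a x) V - meanDualGrad μ ε w a V‖ ≤ 2 * √J :=
    (norm_sub_le _ _).trans
      (by linarith [norm_semiDualGrad_le (ε := ε) (a := a x) (v := V) hA.weight_pos hA.weight_sum])
  have h1 := norm_step_le hκ hα hS (semiDualGrad ε w (a x) V - meanDualGrad μ ε w a V)
  have hn : 0 ≤ (n : ℝ) ^ α := by positivity
  rw [noise, abs_mul, abs_of_nonneg hn]
  calc _ ≤ (n : ℝ) ^ α * (‖meanDualGrad μ ε w a V‖ *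
        ‖Matrix.toEuclideanLin S⁻¹ (semiDualGrad ε w (a x) V - meanDualGrad μ ε w a V)‖) := by
        gcongr; exact abs_real_inner_le_norm _ _
    _ = ‖meanDualGrad μ ε w a V‖ * ((n : ℝ) ^ α *
        ‖Matrix.toEuclideanLin S⁻¹ (semiDualGrad ε w (a x) V - meanDualGrad μ ε w a V)‖) := by
        ring
    _ ≤ √J * (2 * √J / κ * (n + 1 : ℝ) ^ (α + β - 1)) := by
        refine mul_le_mul hG (h1.trans (by gcongr)) (by positivity) (by positivity)
    _ = _ := by ring

variable {x : ℕ → 𝒳} {V : ℕ → EuclideanSpace ℝ (Fin J)} {S : ℕ → Matrix (Fin J) (Fin J) ℝ}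

lemma IsRun.sum_eq_zero [Nonempty (Fin J)] {b : ℕ → Fin J → ℝ} (hR : IsRun ε w α β γ b V S)
    {n : ℕ} (hn : 1 ≤ n) : ∑ j, V n j = 0 := by
  obtain ⟨n, rfl⟩ := Nat.exists_eq_add_of_le' hn
  rw [hR.succ]
  exact sum_center _

lemma IsRun.exists_tendsto_meanDual (hA : Admissible μ ε w a) (hα : 0 ≤ α) (hβ : 0 < β)
    (hγ : 0 < γ) (hαβ : α + β < 1 / 2) (hR : IsRun ε w α β γ (fun n => a (x n)) V S) {l : ℝ}
    (hξ : Tendsto (fun n => ∑ k ∈ Finset.range n, noise μ ε w a α k (V k) (S k) (x k)) atTop (𝓝 l)) :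
    (∃ L, Tendsto (fun n => meanDual μ ε w a (V n)) atTop (𝓝 L)) ∧
      ∀ δ > 0, ∃ᶠ n in atTop, ‖meanDualGrad μ ε w a (V n)‖ ^ 2 < δ := by
  have := hA.nonempty
  have hε := hA.eps_pos
  obtain ⟨v₀, -, hv₀⟩ := hA.exists_minimizer
  obtain ⟨κ, hκ, hSκ⟩ :=
    IsPreconditioner.exists_le_inner (γ := γ) (β := β) hA.weight_pos hA.weight_sum hγ hβ
  have hS := hSκ _ _ hR.precond
  have hSL := hR.precond.inner_le hA.weight_pos hA.weight_sum hγ hβ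
    (fun n => norm_semiDualGrad_le hA.weight_pos hA.weight_sum)
  have hlow : ∀ n : ℕ, ∀ g : EuclideanSpace ℝ (Fin J), ‖g‖ ^ 2 / ((1 + J + γ) * (n + 1)) ≤
      inner ℝ g (Matrix.toEuclideanLin (S n)⁻¹ g) := fun n g =>
    le_inner_toEuclideanLin_inv (hR.precond.isHermitian n) (by positivity) (by positivity)
      (hS n) (hSL n) g
  set d : ℕ → ℝ := fun n => (n : ℝ) ^ α * inner ℝ (meanDualGrad μ ε w a (V n))
    (Matrix.toEuclideanLin (S n)⁻¹ (meanDualGrad μ ε w a (V n))) with hd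
  have hd0 : ∀ n, 0 ≤ d n := fun n =>
    mul_nonneg (by positivity) (le_trans (by positivity) (hlow n _))
  set e : ℕ → ℝ := fun n => 4 / ε * (√J / κ * (n + 1 : ℝ) ^ (α + β - 1)) ^ 2 with he
  have hdesc : ∀ n, meanDual μ ε w a (V (n + 1)) ≤ meanDual μ ε w a (V n) - d n
      - noise μ ε w a α n (V n) (S n) (x n) + e n := fun n => by
    set φ := semiDualGrad ε w (a (x n)) (V n) with hφ
    set G := meanDualGrad μ ε w a (V n) with hG
    set u := (n : ℝ) ^ α • Matrix.toEuclideanLin (S n)⁻¹ φ with hu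
    have h1 := hA.meanDual_add_le (V n) (-u)
    -- The projection is invisible to H, so smoothness along the unprojected step controls
    -- H(V_(n+1)).
    rw [← sub_eq_add_neg, ← hA.meanDual_center, hu, hφ, ← hR.succ n, ← hφ, ← hu, norm_neg,
      inner_neg_right, ← hG] at h1
    have h2 : inner ℝ G u = d n + noise μ ε w a α n (V n) (S n) (x n) := by
      rw [hd, noise, ← hG, ← hφ, hu, map_sub, inner_sub_right, real_inner_smul_right]
      ring
    have h3 : ‖u‖ ≤ √J / κ * (n + 1 : ℝ) ^ (α + β - 1) := by
      rw [hu, norm_smul, Real.norm_of_nonneg (by positivity)]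
      refine (norm_step_le hκ hα (hS n) φ).trans ?_
      gcongr
      exact norm_semiDualGrad_le hA.weight_pos hA.weight_sum
    have h4 : 4 / ε * ‖u‖ ^ 2 ≤ e n := by
      simp only [he]
      gcongr
    linarith
  obtain ⟨h1, h2⟩ := exists_tendsto_and_summable_of_descent (fun n => hv₀ (V n)) hd0
    ((summable_sq_rpow hαβ _).mul_left (4 / ε)) hξ hdesc
  refine ⟨h1, fun δ hδ => frequently_lt_of_summable_div (L := 1 + J + γ) (by positivity) h2 ?_ hδ⟩
  -- At n = 0 the factor n^α is 0 when α > 0, so the comparison starts at n = 1.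
  filter_upwards [eventually_ge_atTop 1] with n hn
  have h3 : (1 : ℝ) ≤ (n : ℝ) ^ α := Real.one_le_rpow (by exact_mod_cast hn) hα
  exact (hlow n _).trans (le_mul_of_one_le_left (le_trans (by positivity) (hlow n _)) h3)

/-- The iterates converge to the centered minimizer once the noise is summable. -/
lemma IsRun.tendsto_minimizer (hA : Admissible μ ε w a) (hα : 0 ≤ α) (hβ : 0 < β)
    (hγ : 0 < γ) (hαβ : α + β < 1 / 2) (hR : IsRun ε w α β γ (fun n => a (x n)) V S) {l : ℝ}
    (hξ : Tendsto (fun n => ∑ k ∈ Finset.range n, noise μ ε w a α k (V k) (S k) (x k)) atTop (𝓝 l))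
    {v : EuclideanSpace ℝ (Fin J)} (hv0 : ∑ j, v j = 0)
    (hv : ∀ z, meanDual μ ε w a v ≤ meanDual μ ε w a z) : Tendsto V atTop (𝓝 v) := by
  have := hA.nonempty
  obtain ⟨⟨L, hL⟩, hfreq⟩ := hR.exists_tendsto_meanDual hA hα hβ hγ hαβ hξ
  obtain ⟨B, hB⟩ := hL.bddAbove_range
  obtain ⟨R, hRb⟩ := hA.exists_norm_le_of_meanDual_le B
  have hVR : ∀ᶠ n in atTop, ‖V n‖ ≤ R := by
    filter_upwards [eventually_ge_atTop 1] with n hn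
    exact hRb _ (hR.sum_eq_zero hn) (hB ⟨n, rfl⟩)
  have hR0 : 0 ≤ R := by
    obtain ⟨n, hn⟩ := hVR.exists
    exact (norm_nonneg _).trans hn
  -- Convexity gives H(V_n) - H(v) ≤ ‖∇H(V_n)‖ ‖V_n - v‖, at most δ infinitely often; since H(V_n)
  -- converges, that bounds its limit.
  have hLv : L = meanDual μ ε w a v := by
    refine le_antisymm (le_of_forall_pos_le_add fun δ hδ => ?_)
      (ge_of_tendsto' hL fun n => hv _)
    set C := R + ‖v‖ + 1 with hC
    have hC0 : 0 < C := by positivity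
    refine le_of_tendsto_of_frequently hL ?_
    refine ((hfreq ((δ / C) ^ 2) (by positivity)).and_eventually hVR).mono fun n hn => ?_
    have h1 := hA.meanDual_add_ge (V n) (v - V n)
    rw [add_sub_cancel] at h1
    have h2 := (abs_le.1 (abs_real_inner_le_norm (meanDualGrad μ ε w a (V n)) (v - V n))).1
    have h3 : ‖meanDualGrad μ ε w a (V n)‖ ≤ δ / C :=
      (lt_of_pow_lt_pow_left₀ 2 (by positivity) hn.1).le
    have h4 : ‖v - V n‖ ≤ C := (norm_sub_le _ _).trans (by linarith [hn.2])
    have h5 : ‖meanDualGrad μ ε w a (V n)‖ * ‖v - V n‖ ≤ δ := by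
      calc _ ≤ δ / C * C := by gcongr
        _ = δ := by field_simp
    linarith
  have hK : IsCompact ({v | ∑ j, v j = 0} ∩ Metric.closedBall (0 : EuclideanSpace ℝ (Fin J)) R) :=
    (isCompact_closedBall 0 R).inter_left (isClosed_eq (by fun_prop) continuous_const)
  -- Any cluster point is centered and has the minimal value of H, hence equals v.
  refine hK.tendsto_nhds_of_unique_mapClusterPt ?_ fun z hz hzV => ?_
  · filter_upwards [hVR, eventually_ge_atTop 1] with n hn hn1
    exact ⟨hR.sum_eq_zero hn1, by simpa using hn⟩
  · have h1 := hzV.continuousAt_comp (hA.continuous_meanDual.continuousAt (x := z))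
    have h2 : meanDual μ ε w a z = L := eq_of_nhds_neBot (NeBot.mono h1 (inf_le_inf_left _ hL))
    exact hA.minimizer_unique hv0 hz.1 hv (h2.trans hLv)

end Run

/-! ### Measurability of the recursion and centering of the noise -/

section Measurability

variable {J : ℕ} {A : Type*} [MeasurableSpace A]

lemma measurable_det_of_apply {M : A → Matrix (Fin J) (Fin J) ℝ}
    (hM : ∀ i j, Measurable fun p => M p i j) : Measurable fun p => (M p).det := by
  simp only [Matrix.det_apply]
  refine Finset.measurable_sum _ fun σ _ => ?_
  exact (Finset.measurable_prod _ fun i _ => hM _ _).const_smul _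

lemma measurable_inv_apply {M : A → Matrix (Fin J) (Fin J) ℝ}
    (hM : ∀ i j, Measurable fun p => M p i j) (i j : Fin J) :
    Measurable fun p => (M p)⁻¹ i j := by
  simp only [Matrix.inv_def, Matrix.smul_apply, Ring.inverse_eq_inv', Matrix.adjugate_apply,
    smul_eq_mul]
  refine (measurable_det_of_apply hM).inv.mul (measurable_det_of_apply fun k l => ?_)
  simp only [Matrix.updateRow_apply]
  split_ifs
  · exact measurable_const
  · exact hM k l

lemma measurable_toEuclideanLin_apply {M : A → Matrix (Fin J) (Fin J) ℝ}
    {g : A → EuclideanSpace ℝ (Fin J)} (hM : ∀ i j, Measurable fun p => M p i j)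
    (hg : Measurable g) : Measurable fun p => Matrix.toEuclideanLin (M p) (g p) := by
  simp only [Matrix.toLpLin_apply]
  refine (WithLp.measurable_toLp 2 _).comp (measurable_pi_lambda _ fun i => ?_)
  simp only [Matrix.mulVec, dotProduct]
  exact Finset.measurable_sum _ fun j _ => (hM i j).mul (by fun_prop)

lemma measurable_center : Measurable (center (J := J)) := by
  unfold center
  refine measurable_id.add ((WithLp.measurable_toLp 2 _).comp (measurable_pi_lambda _ fun i => ?_))
  fun_prop

variable {𝒳 : Type*} [MeasurableSpace 𝒳] {μ : Measure 𝒳} [IsProbabilityMeasure μ] {ε : ℝ}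
  {w : Fin J → ℝ} {a : 𝒳 → Fin J → ℝ}

lemma measurable_noise (ha : Measurable a) (α : ℝ) (n : ℕ) :
    Measurable fun p : (EuclideanSpace ℝ (Fin J) × (Fin J → Fin J → ℝ)) × 𝒳 =>
      noise μ ε w a α n p.1.1 (Matrix.of p.1.2) p.2 := by
  have hG : Measurable fun p : (EuclideanSpace ℝ (Fin J) × (Fin J → Fin J → ℝ)) × 𝒳 =>
      meanDualGrad μ ε w a p.1.1 := (measurable_meanDualGrad ha).comp (by fun_prop)
  have hg : Measurable fun p : (EuclideanSpace ℝ (Fin J) × (Fin J → Fin J → ℝ)) × 𝒳 =>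
      semiDualGrad ε w (a p.2) p.1.1 :=
    Measurable.comp (g := fun p : 𝒳 × EuclideanSpace ℝ (Fin J) => semiDualGrad ε w (a p.1) p.2)
      (f := fun p : (EuclideanSpace ℝ (Fin J) × (Fin J → Fin J → ℝ)) × 𝒳 => (p.2, p.1.1))
      (measurable_semiDualGrad ha) (by fun_prop)
  have hM := measurable_inv_apply
    (M := fun p : (EuclideanSpace ℝ (Fin J) × (Fin J → Fin J → ℝ)) × 𝒳 => Matrix.of p.1.2)
    fun i j => by simp only [Matrix.of_apply]; fun_prop
  exact (hG.inner (measurable_toEuclideanLin_apply hM (hg.sub hG))).const_mul _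

lemma measurable_pair {A : Type*} {mA : MeasurableSpace A} {V : A → EuclideanSpace ℝ (Fin J)}
    {S : A → Matrix (Fin J) (Fin J) ℝ} (hV : Measurable V)
    (hS : ∀ i j, Measurable fun p => S p i j) :
    Measurable fun p =>
      ((V p, fun i j => S p i j) : EuclideanSpace ℝ (Fin J) × (Fin J → Fin J → ℝ)) :=
  hV.prodMk (measurable_pi_lambda _ fun i => measurable_pi_lambda _ fun j => hS i j)

lemma measurable_noise_comp {A : Type*} {mA : MeasurableSpace A} (ha : Measurable a)
    {V : A → EuclideanSpace ℝ (Fin J)} {S : A → Matrix (Fin J) (Fin J) ℝ} {X : A → 𝒳}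
    (hV : Measurable V) (hS : ∀ i j, Measurable fun p => S p i j) (hX : Measurable X)
    (α : ℝ) (n : ℕ) : Measurable fun p => noise μ ε w a α n (V p) (S p) (X p) :=
  Measurable.comp (g := fun p : (EuclideanSpace ℝ (Fin J) × (Fin J → Fin J → ℝ)) × 𝒳 =>
    noise μ ε w a α n p.1.1 (Matrix.of p.1.2) p.2) (f := fun p => ((V p, fun i j => S p i j), X p))
    (measurable_noise ha α n) ((measurable_pair hV hS).prodMk hX)

lemma measurable_step {A : Type*} {mA : MeasurableSpace A} (ha : Measurable a)
    {V : A → EuclideanSpace ℝ (Fin J)} {S : A → Matrix (Fin J) (Fin J) ℝ} {X : A → 𝒳}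
    (hV : Measurable V) (hS : ∀ i j, Measurable fun p => S p i j) (hX : Measurable X) (s : ℝ)
    (Q : Matrix (Fin J) (Fin J) ℝ) :
    Measurable (fun p => center (V p - s •
        Matrix.toEuclideanLin (S p)⁻¹ (semiDualGrad ε w (a (X p)) (V p)))) ∧
      ∀ i j, Measurable fun p => (S p + Matrix.vecMulVec
        (semiDualGrad ε w (a (X p)) (V p)) (semiDualGrad ε w (a (X p)) (V p)) + Q) i j := by
  have hg : Measurable fun p => semiDualGrad ε w (a (X p)) (V p) :=
    Measurable.comp (g := fun p : 𝒳 × EuclideanSpace ℝ (Fin J) => semiDualGrad ε w (a p.1) p.2)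
      (f := fun p => (X p, V p)) (measurable_semiDualGrad ha) (hX.prodMk hV)
  have hgj : ∀ j, Measurable fun p => semiDualGrad ε w (a (X p)) (V p) j := fun j =>
    (measurable_pi_apply j).comp ((WithLp.measurable_ofLp 2 _).comp hg)
  refine ⟨?_, fun i j => ?_⟩
  · exact measurable_center.comp
      (hV.sub ((measurable_toEuclideanLin_apply (measurable_inv_apply hS) hg).const_smul s))
  · simp only [Matrix.add_apply, Matrix.vecMulVec_apply]
    exact ((hS i j).add ((hgj i).mul (hgj j))).add measurable_const

/-- With V and S frozen, the noise is a linear functional of the gradient fluctuation, which has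
mean zero. -/
lemma integral_noise (hA : Admissible μ ε w a) (α : ℝ) (n : ℕ) (V : EuclideanSpace ℝ (Fin J))
    (S : Matrix (Fin J) (Fin J) ℝ) : ∫ x, noise μ ε w a α n V S x ∂μ = 0 := by
  simp only [noise, integral_const_mul, ← LinearMap.adjoint_inner_left, inner_sub_right]
  set u := LinearMap.adjoint (Matrix.toEuclideanLin S⁻¹) (meanDualGrad μ ε w a V)
  have h1 := integrable_inner_semiDualGrad (ε := ε) (μ := μ) hA.weight_pos hA.weight_sum
    hA.measurable V u
  have h2 := integral_inner_semiDualGrad (ε := ε) (μ := μ) hA.weight_pos hA.weight_sum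
    hA.measurable V u
  simp only [real_inner_comm u] at h1 h2
  rw [integral_sub h1 (integrable_const _), h2]
  simp

end Measurability

/-! ### The stochastic algorithm and its estimator -/

section Algorithm

variable {𝒳 𝒴 : Type*} {J : ℕ}

lemma toEuclideanLin_projMatrix (v : EuclideanSpace ℝ (Fin J)) :
    Matrix.toEuclideanLin (projMatrix J) v = center v := by
  ext i
  have hJ : √(J : ℝ) * √J = J := Real.mul_self_sqrt (Nat.cast_nonneg J)
  have hJ0 : (J : ℝ) ≠ 0 := by exact_mod_cast i.pos.ne'
  rw [Matrix.toLpLin_apply, projMatrix, Matrix.sub_mulVec, Matrix.one_mulVec]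
  simp only [Matrix.mulVec, dotProduct, Matrix.vecMulVec_apply, unitVec, center, PiLp.add_apply,
    Pi.sub_apply, ← Finset.mul_sum, sub_eq_add_neg]
  congr 2
  rw [div_mul_div_comm, hJ]
  ring

lemma h_eq_semiDual (c : 𝒳 × 𝒴 → ℝ) (ε : ℝ) (y : Fin J → 𝒴) (w : Fin J → ℝ) (x : 𝒳) :
    h c ε y w x = semiDual ε w fun j => c (x, y j) := rfl

lemma isRun_sgn [Nonempty (Fin J)] (c : 𝒳 × 𝒴 → ℝ) {ε : ℝ} (hε : 0 < ε) (y : Fin J → 𝒴)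
    {w : Fin J → ℝ} (hw : ∀ j, 0 < w j) (α β γ : ℝ) (x : ℕ → 𝒳)
    (v₀ : EuclideanSpace ℝ (Fin J)) :
    IsRun ε w α β γ (fun n j => c (x n, y j)) (fun n => (sgn c ε y w α β γ x v₀ n).1)
      (fun n => (sgn c ε y w α β γ x v₀ n).2) := by
  have hgrad : ∀ n v, gradient (h c ε y w (x n)) v =
      semiDualGrad ε w (fun j => c (x n, y j)) v := fun n v => by
    rw [h_eq_semiDual]
    exact (hasGradientAt_semiDual hε hw).gradient
  refine ⟨⟨rfl, fun n => ?_⟩, fun n => ?_⟩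
  · simp only [← hgrad]; rfl
  · simp only [← hgrad, ← toEuclideanLin_projMatrix]; rfl

lemma What_eq (c : 𝒳 × 𝒴 → ℝ) (ε : ℝ) (y : Fin J → 𝒴) (w : Fin J → ℝ) (α β γ : ℝ)
    (x : ℕ → 𝒳) (v₀ : EuclideanSpace ℝ (Fin J)) (n : ℕ) :
    What c ε y w α β γ x v₀ n = -((n : ℝ)⁻¹ * ∑ k ∈ Finset.range n,
      semiDual ε w (fun j => c (x k, y j)) (sgn c ε y w α β γ x v₀ k).1) := by
  have hsum : ∀ f : ℕ → ℝ, ∑ k ∈ Finset.Icc 1 n, f (k - 1) = ∑ k ∈ Finset.range n, f k := fun f => by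
    induction n with
    | zero => simp
    | succ n ih => rw [Finset.sum_Icc_succ_top (by omega), ih, Finset.sum_range_succ]; rfl
  rw [What, hsum fun k => h c ε y w (x k) (sgn c ε y w α β γ x v₀ k).1]
  simp only [h_eq_semiDual, one_div, neg_mul]

variable {Ω : Type*} {mΩ : MeasurableSpace Ω} {P : Measure Ω} [IsProbabilityMeasure P]
  [MeasurableSpace 𝒳] {μ : Measure 𝒳} [IsProbabilityMeasure μ]
  {c : 𝒳 × 𝒴 → ℝ} {ε : ℝ} {y : Fin J → 𝒴} {w : Fin J → ℝ} {α β γ : ℝ}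
  {X : ℕ → Ω → 𝒳} {V₀ : Ω → EuclideanSpace ℝ (Fin J)}

lemma measurable_sgn (hA : Admissible μ ε w fun x j => c (x, y j)) (hV : Measurable V₀)
    (hX : ∀ n, Measurable (X n)) (n : ℕ) :
    Measurable[history hV hX n]
        (fun ω => (sgn c ε y w α β γ (fun k => X k ω) (V₀ ω) n).1) ∧
      ∀ i j, Measurable[history hV hX n]
        (fun ω => (sgn c ε y w α β γ (fun k => X k ω) (V₀ ω) n).2 i j) := by
  have := hA.nonempty
  have hrun := fun ω => isRun_sgn c hA.eps_pos y hA.weight_pos α β γ (fun k => X k ω) (V₀ ω)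
  induction n with
  | zero => exact ⟨measurable_history_init hV hX 0, fun i j => measurable_const⟩
  | succ n ih =>
    have hle : (history hV hX n : MeasurableSpace Ω) ≤ history hV hX (n + 1) :=
      (history hV hX).mono n.le_succ
    have h1 := ih.1.mono hle le_rfl
    have h2 := fun i j => (ih.2 i j).mono hle le_rfl
    have hstep := measurable_step (ε := ε) (w := w) hA.measurable h1 h2
      (measurable_history_sample hV hX n) ((n : ℝ) ^ α)
      ((γ * (1 + (((n + 1) / J : ℕ) : ℝ)) ^ (-β)) •
        Matrix.vecMulVec (Z w (n + 1)) (Z w (n + 1)))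
    simp only [(hrun _).succ, (hrun _).precond.succ]
    exact hstep

/-- Almost sure convergence of an adapted run to the centered minimizer. -/
lemma ae_tendsto_of_isRun {a : 𝒳 → Fin J → ℝ} {V : ℕ → Ω → EuclideanSpace ℝ (Fin J)}
    {S : ℕ → Ω → Matrix (Fin J) (Fin J) ℝ} {V₀ : Ω → EuclideanSpace ℝ (Fin J)}
    (hA : Admissible μ ε w a) (hα : 0 ≤ α) (hβ : 0 < β)
    (hγ : 0 < γ) (hαβ : α + β < 1 / 2) (hV₀ : Measurable V₀) (hX : ∀ n, Measurable (X n))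
    (hXlaw : ∀ n, P.map (X n) = μ) (hXi : iIndepFun X P)
    (hVX : IndepFun V₀ (fun ω n => X n ω) P)
    (hrun : ∀ ω, IsRun ε w α β γ (fun n => a (X n ω)) (fun n => V n ω) (fun n => S n ω))
    (hV : ∀ n, Measurable[history hV₀ hX n] (V n))
    (hS : ∀ n i j, Measurable[history hV₀ hX n] fun ω => S n ω i j)
    {v : EuclideanSpace ℝ (Fin J)} (hv0 : ∑ j, v j = 0)
    (hv : ∀ z, meanDual μ ε w a v ≤ meanDual μ ε w a z) :
    ∀ᵐ ω ∂P, Tendsto (fun n => V n ω) atTop (𝓝 v) := by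
  obtain ⟨κ, hκ, hSκ⟩ :=
    IsPreconditioner.exists_le_inner (γ := γ) (β := β) hA.weight_pos hA.weight_sum hγ hβ
  -- Because κ does not depend on ω, the martingale increments have a deterministic square-summable
  -- bound.
  have hb : ∀ n ω, |noise μ ε w a α n (V n ω) (S n ω) (X n ω)| ≤
      √J * (2 * √J / κ) * (n + 1 : ℝ) ^ (α + β - 1) := fun n ω =>
    abs_noise_le hA hκ hα (hSκ _ _ (hrun ω).precond n) _ _
  have hY := fun n => measurable_pair (hV n) (hS n)
  have hle : ∀ n, (history hV₀ hX n : MeasurableSpace Ω) ≤ history hV₀ hX (n + 1) := fun n =>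
    (history hV₀ hX).mono n.le_succ
  have hξm : ∀ n, Measurable[history hV₀ hX (n + 1)]
      fun ω => noise μ ε w a α n (V n ω) (S n ω) (X n ω) := fun n =>
    measurable_noise_comp hA.measurable ((hV n).mono (hle n) le_rfl)
      (fun i j => (hS n i j).mono (hle n) le_rfl) (measurable_history_sample hV₀ hX n) α n
  have hξΩ : ∀ n, Measurable fun ω => noise μ ε w a α n (V n ω) (S n ω) (X n ω) := fun n =>
    (hξm n).mono ((history hV₀ hX).le _) le_rfl
  have hξi : ∀ n, Integrable (fun ω => noise μ ε w a α n (V n ω) (S n ω) (X n ω)) P := fun n =>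
    Integrable.of_bound (hξΩ n).aestronglyMeasurable _ (Eventually.of_forall (hb n))
  have h0 : ∀ n, P[fun ω => noise μ ε w a α n (V n ω) (S n ω) (X n ω) | history hV₀ hX n]
      =ᵐ[P] 0 := fun n =>
    condExp_eq_zero_of_indep ((history hV₀ hX).le n) (hY n) (hX n)
      (indep_history hV₀ hX hXi hVX n)
      (f := fun p => noise μ ε w a α n p.1.1 (Matrix.of p.1.2) p.2)
      (measurable_noise hA.measurable α n) (hξi n) fun t => by
        rw [hXlaw]; exact integral_noise hA α n t.1 (Matrix.of t.2)
  have hξs : ∀ n, StronglyMeasurable[history hV₀ hX (n + 1)]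
      fun ω => noise μ ε w a α n (V n ω) (S n ω) (X n ω) := fun n => (hξm n).stronglyMeasurable
  have hconv := ae_exists_tendsto_sum_of_condExp_eq_zero hξs hb (summable_sq_rpow hαβ _) h0
  filter_upwards [hconv] with ω hω
  obtain ⟨l, hl⟩ := hω
  exact (hrun ω).tendsto_minimizer hA hα hβ hγ hαβ hl hv0 hv

lemma ae_tendsto_average_semiDual {a : 𝒳 → Fin J → ℝ} (hA : Admissible μ ε w a)
    (hX : ∀ n, Measurable (X n)) (hXlaw : ∀ n, P.map (X n) = μ) (hXi : iIndepFun X P)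
    (v : EuclideanSpace ℝ (Fin J)) :
    ∀ᵐ ω ∂P, Tendsto (fun n : ℕ => (n : ℝ)⁻¹ * ∑ k ∈ Finset.range n,
      semiDual ε w (a (X k ω)) v) atTop (𝓝 (meanDual μ ε w a v)) := by
  have hm : Measurable fun x => semiDual ε w (a x) v :=
    Measurable.comp (g := fun p : 𝒳 × EuclideanSpace ℝ (Fin J) => semiDual ε w (a p.1) p.2)
      (f := fun x => (x, v)) (measurable_semiDual hA.measurable) (by fun_prop)
  have hi : Integrable (fun ω => semiDual ε w (a (X 0 ω)) v) P := by
    have := hA.integrable_semiDual v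
    rw [← hXlaw 0] at this
    exact this.comp_measurable (hX 0)
  have h := strong_law_ae_real (fun n ω => semiDual ε w (a (X n ω)) v) hi
    (fun i j hij => (hXi.indepFun hij).comp hm hm)
    (fun i => IdentDistrib.comp ⟨(hX i).aemeasurable, (hX 0).aemeasurable,
      (hXlaw i).trans (hXlaw 0).symm⟩ hm)
  have hmean : ∫ ω, semiDual ε w (a (X 0 ω)) v ∂P = meanDual μ ε w a v := by
    rw [meanDual, ← hXlaw 0, integral_map (hX 0).aemeasurable hm.aestronglyMeasurable]
  filter_upwards [h] with ω hω
  rw [hmean] at hω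
  simpa only [div_eq_inv_mul] using hω

/-- Almost sure convergence of the recursive estimator for a measurable initial value. -/
lemma ae_tendsto_What (hA : Admissible μ ε w fun x j => c (x, y j)) (hα : 0 ≤ α) (hβ : 0 < β)
    (hγ : 0 < γ) (hαβ : α + β < 1 / 2) (hV : Measurable V₀) (hX : ∀ n, Measurable (X n))
    (hXlaw : ∀ n, P.map (X n) = μ) (hXi : iIndepFun X P)
    (hVX : IndepFun V₀ (fun ω n => X n ω) P) {v : EuclideanSpace ℝ (Fin J)}
    (hv0 : ∑ j, v j = 0) (hv : ∀ z, meanDual μ ε w (fun x j => c (x, y j)) v ≤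
      meanDual μ ε w (fun x j => c (x, y j)) z) :
    ∀ᵐ ω ∂P, Tendsto (fun n => What c ε y w α β γ (fun k => X k ω) (V₀ ω) n) atTop
      (𝓝 (-meanDual μ ε w (fun x j => c (x, y j)) v)) := by
  have := hA.nonempty
  have hconv := ae_tendsto_of_isRun (α := α) (β := β) (γ := γ) hA hα hβ hγ hαβ hV hX hXlaw hXi hVX
    (fun ω => isRun_sgn c hA.eps_pos y hA.weight_pos α β γ (fun k => X k ω) (V₀ ω))
    (fun n => (measurable_sgn hA hV hX n).1) (fun n => (measurable_sgn hA hV hX n).2) hv0 hv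
  filter_upwards [hconv,
    ae_tendsto_average_semiDual hA hX hXlaw hXi v] with ω h1 h2
  simp only [What_eq]
  refine Tendsto.neg ?_
  set V := fun n => (sgn c ε y w α β γ (fun k => X k ω) (V₀ ω) n).1
  have h3 : Tendsto (fun n => √J * ‖V n - v‖) atTop (𝓝 0) := by
    have := ((tendsto_iff_norm_sub_tendsto_zero.1 h1).const_mul √J)
    rwa [mul_zero] at this
  -- The Lipschitz constant √J does not depend on the cost vector, so the random X_n plays no role
  -- in this error.
  have h4 : Tendsto (fun n => semiDual ε w (fun j => c (X n ω, y j)) (V n)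
      - semiDual ε w (fun j => c (X n ω, y j)) v) atTop (𝓝 0) :=
    squeeze_zero_norm (fun n => abs_semiDual_sub_le hA.eps_pos hA.weight_pos hA.weight_sum _ _) h3
  have h5 := h4.cesaro.add h2
  rw [zero_add] at h5
  refine h5.congr fun n => ?_
  rw [← mul_add, ← Finset.sum_add_distrib]
  simp only [sub_add_cancel, V]

end Algorithm

end

end RegOT

theorem corollary1
    {𝒳 𝒴 Ω : Type*}
    [MetricSpace 𝒳] [MeasurableSpace 𝒳] [BorelSpace 𝒳]
    [MetricSpace 𝒴] [MeasurableSpace 𝒴] [BorelSpace 𝒴]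
    [MeasurableSpace Ω] (P : Measure Ω) [IsProbabilityMeasure P]
    (μ : Measure 𝒳) [IsProbabilityMeasure μ]
    {J : ℕ} (y : Fin J → 𝒴) (hy : Function.Injective y)
    (w : Fin J → ℝ) (hw : ∀ j, 0 < w j) (hw1 : ∑ j, w j = 1)
    (c : 𝒳 × 𝒴 → ℝ) (hc : LowerSemicontinuous c) (hc0 : ∀ z, 0 ≤ c z)
    (hc2 : ∀ j, Integrable (fun x => c (x, y j) ^ 2) μ)
    (ε : ℝ) (hε : 0 < ε)
    (α β γ : ℝ) (hα : 0 ≤ α ∧ α < 1 / 2) (hβ : 0 < β ∧ β < 1 / 2) (hγ : 0 < γ)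
    (hαβ : α + β < 1 / 2)
    (X : ℕ → Ω → 𝒳) (hX : ∀ n, Measurable (X n)) (hXlaw : ∀ n, P.map (X n) = μ)
    (hXindep : iIndepFun X P)
    (V₀ : Ω → EuclideanSpace ℝ (Fin J)) (hV₀ : MemLp V₀ 2 P)
    (hV₀perp : ∀ᵐ ω ∂P, V₀ ω ∈ (Submodule.span ℝ {RegOT.unitVec J})ᗮ)
    (hV₀indep : IndepFun V₀ (fun ω n => X n ω) P) :
    (∃ π ∈ RegOT.couplings μ (RegOT.discreteMeasure y w),
      RegOT.transportCost c ε μ (RegOT.discreteMeasure y w) π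
        = RegOT.W c ε μ (RegOT.discreteMeasure y w)) ∧
    ∃ W : ℝ, RegOT.W c ε μ (RegOT.discreteMeasure y w) = (W : EReal) ∧
      ∀ᵐ ω ∂P, Tendsto
        (fun n => RegOT.What c ε y w α β γ (fun k => X k ω) (V₀ ω) n) atTop (𝓝 W) := by
  have hcm : ∀ j, Measurable fun x => c (x, y j) := fun j =>
    LowerSemicontinuous.measurable (hc.comp (g := fun x => (x, y j)) (by fun_prop))
  have hA : RegOT.Admissible μ ε w fun x j => c (x, y j) :=
    ⟨hε, hw, hw1, measurable_pi_lambda _ hcm, fun x j => hc0 _, fun j =>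
      ((memLp_two_iff_integrable_sq (hcm j).aestronglyMeasurable).2 (hc2 j)).integrable
        one_le_two⟩
  obtain ⟨v, hv0, hv⟩ := hA.exists_minimizer
  have hG := hA.meanDualGrad_eq_zero hv
  have hπ := RegOT.gibbsCoupling_mem_couplings hA hy hG
  have hcost := RegOT.transportCost_gibbsCoupling hy hc0 hA hG
  have hW : RegOT.W c ε μ (RegOT.discreteMeasure y w) =
      ((-RegOT.meanDual μ ε w (fun x j => c (x, y j)) v : ℝ) : EReal) :=
    le_antisymm (hcost ▸ iInf₂_le _ hπ)
      (le_iInf₂ fun π hπ => RegOT.neg_meanDual_le_transportCost hy hc0 hA v hπ)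
  refine ⟨⟨_, hπ, hcost.trans hW.symm⟩, _, hW, ?_⟩
  -- V₀ is only almost everywhere measurable, whereas the history filtration needs a measurable
  -- initial value; a measurable version has the same independence and the same trajectories almost
  -- surely.
  have hVae : AEMeasurable V₀ P := hV₀.aestronglyMeasurable.aemeasurable
  have hlim := RegOT.ae_tendsto_What hA hα.1 hβ.1 hγ hαβ hVae.measurable_mk hX hXlaw hXindep
    (hV₀indep.congr hVae.ae_eq_mk (ae_eq_refl _)) hv0 hv
  filter_upwards [hlim, hVae.ae_eq_mk] with ω h1 h2
  rwa [h2]
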